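/- **Setting.** A *branching bandit* consists of a measurable space $X$ of informational states of actions, a Markov kernel and a continuation factor $\delta(x)\in[0,1]$ (measurable in $x$). Selecting an action in state $x$ draws jointly, with a law that depends only on $x$, an immediate payoff and a finite list of new actions (its follow-up actions, with their states); payoffs of all later stages are multiplied by $\delta(x)$ ($\delta=0$: the action ends the process, such as a purchase; $\delta=1$: no discounting, such as a costly inspection or discovery). *Independence*: the outcome reveals only the selected action's own follow-up actions. *Invariance*: the selected action leaves the choice set for good, its follow-up actions enter, and all other actions stay available with unchanged states. Each follow-up action has a unique parent. An outside option with payoff $u_0\in\mathbb R$ is always available; taking it ends the process. For a finite list $s$ of available actions and an outside option $m\in\mathbb R$, let $V(m;s)$ be the supremum of the expected total (discounted) payoff over all measurable history-dependent decision rules that take the outside option after a bounded number of actions at the latest, unless the process has ended before. An option is an *optimal choice* at $(m;s)$ if the supremum over the rules whose first choice is this option is also $V(m;s)$. The *value* of an action in state $x$ is its Gittins index $\mathcal G(x)=\inf\{m\in\mathbb R: V(m;\{x\})=m\}\in[-\infty,\infty]$, the minimum guaranteed payoff at which the consumer is indifferent between stopping and continuing with this action; the value of the outside option is $u_0$. Assume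 that - the total absolute payoff of an action and of its descendants in any given finite number of generations has finite expectation, and for every $x$ there is $m\in\mathbb R$ with $V(m;\{x\})=m$ (boundary condition); - no action is free: for every $x$, $\delta(x)<1$ or the expected immediate payoff is negative. Consider a realized process with finitely many steps that starts from a finite set of available actions. In step $j$ one option of the current choice set (the available actions and the outside option) is selected; only the last step may take the outside option or select an action with $\delta=0$. Let $v_j$ be the value of the option selected in step $j$. Suppose that the ranking by value has no ties between selected options: $v_j\neq v_{j+t}$ whenever $t\ge 1$ and the option selected in step $j+t$ is available at step $j$. The process is *optimal* if in every step the selected option is an optimal choice. A step is *forward-accessible* if some option of its choice set that is not selected in it is selected in a later step, and *forward-inaccessible* otherwise. The *sub-core value* $y_\ell$ of an option $\ell$ is the minimum of the values of the options selected in the forward-inaccessible steps from the time on when $\ell$ is available. **Theorem 3.** Such a process is optimal if and only if 1. $v_j>v_{j+t}$ for all $j$ and all $t\ge 1$ for which the option selected in step $j+t$ exists and is available at step $j$; and 2. every option $\ell$ that is available in some step but selected in none has value at most $y_\ell$. -/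

import Mathlib

open MeasureTheory ProbabilityTheory
open scoped ENNReal

/-- Finite lists carry the σ-algebra of finite tuples `(n, x₀, …, xₙ₋₁)`. -/
instance listMeasurableSpace {α : Type*} [MeasurableSpace α] : MeasurableSpace (List α) :=
  MeasurableSpace.comap (fun l : List α => (⟨l.length, l.get⟩ : Σ n : ℕ, (Fin n → α)))
    inferInstance

/-- A branching bandit. A point of `X` is the informational state of an unselected action: all that
the decision maker knows about it.

Selecting an action in state `x` draws, from the law `outcome x`, an immediate payoff and the list
of (the states of) the follow-up actions that become available. The payoffs of all later stages are
multiplied by the continuation factor `cont x`: it is `0` for an action that ends the process (a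
purchase), `1` for an action without discounting (a costly inspection or discovery), and the
discount factor `β` in a discounted bandit.

Independence: the outcome depends only on the state of the selected action, and reveals only its
own follow-up actions. Invariance: the unselected actions stay available, with unchanged states
(see `payoffRest` and `payoffLeave`, where the new choice list is the old one with the selected
action erased and its follow-up actions appended). -/
structure BranchingBandit (X : Type*) [MeasurableSpace X] where
  /-- joint law of the immediate payoff and of the follow-up actions -/
  outcome : Kernel X (ℝ × List X)
  markov : IsMarkovKernel outcome
  /-- continuation factor -/
  cont : X → ℝ
  cont_measurable : Measurable cont
  cont_nonneg : ∀ x, 0 ≤ cont x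
  cont_le_one : ∀ x, cont x ≤ 1

/-- A decision rule: given the history (past immediate payoffs and choice lists, most recent first)
and the current choice list, it names the position of the action to select. A position outside the
list means taking the outside option. -/
structure DecisionRule (X : Type*) [MeasurableSpace X] where
  pick : List (ℝ × List X) → List X → ℕ
  measurable_pick : Measurable fun p : List (ℝ × List X) × List X => pick p.1 p.2

namespace BranchingBandit

variable {X : Type*} [MeasurableSpace X] (B : BranchingBandit X)

/-- Expected payoff of following the rule `π` for at most `n` actions from the choice list `s` after
history `h`, when an outside option of payoff `m` ends the process: it can be taken at any stage,
and is taken when the `n` actions have been used up. -/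
noncomputable def payoff (m : ℝ) (π : DecisionRule X) :
    ℕ → List (ℝ × List X) → List X → ℝ
  | 0, _, _ => m
  | n + 1, h, s =>
    if hi : π.pick h s < s.length then
      ∫ o, (o.1 + B.cont s[π.pick h s] *
          payoff m π n ((o.1, s) :: h) (s.eraseIdx (π.pick h s) ++ o.2))
        ∂(B.outcome s[π.pick h s])
    else m

/-- The optimal value: the supremum of the expected payoff over all decision rules (that stop after
a bounded number of actions), with choice list `s` and outside option `m`. -/
noncomputable def value (m : ℝ) (s : List X) : EReal :=
  ⨆ (π : DecisionRule X) (n : ℕ), ((B.payoff m π n [] s : ℝ) : EReal)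

/-- The supremum of the expected payoff over the decision rules whose first choice is position `i`
of the list `s` (the outside option, if `i` is not a position of `s`). -/
noncomputable def valueVia (m : ℝ) (s : List X) (i : ℕ) : EReal :=
  ⨆ (π : DecisionRule X) (_ : π.pick [] s = i) (n : ℕ), ((B.payoff m π (n + 1) [] s : ℝ) : EReal)

/-- Selecting position `i` (or, if `i` is not a position of `s`, the outside option) is an optimal
choice: no decision rule does better than those that begin with it. -/
def IsOptimalChoice (m : ℝ) (s : List X) (i : ℕ) : Prop :=
  B.valueVia m s i = B.value m s

/-- The Gittins index of an action in state `x`: the minimum guaranteed payoff `m` for which, when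
only this action is available, stopping at once with payoff `m` is as good as continuing. -/
noncomputable def gittins (x : X) : EReal :=
  sInf {g : EReal | ∃ m : ℝ, g = (m : EReal) ∧ B.value m [x] = (m : EReal)}

/-- Expected total absolute payoff of the action itself and of its descendants, through `n`
generations. -/
noncomputable def expAbsPayoff : ℕ → X → ℝ≥0∞
  | 0, _ => 0
  | n + 1, x => ∫⁻ o, (‖o.1‖ₑ + (o.2.map (expAbsPayoff n)).sum) ∂(B.outcome x)

/-- The boundary condition on payoffs: finitely many generations have an integrable total payoff,
and for every action there is a guaranteed payoff so high that stopping at once is optimal. -/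
def BoundaryCondition : Prop :=
  (∀ n x, B.expAbsPayoff n x < ∞) ∧ ∀ x, ∃ m : ℝ, B.value m [x] = (m : EReal)

/-- Actions are not free: each one discounts the future (or ends the process) or has a positive
expected cost. -/
def CostlyActions : Prop :=
  ∀ x, B.cont x < 1 ∨ ∫ o, o.1 ∂(B.outcome x) < 0

end BranchingBandit

/-- A realized decision process of a branching bandit. `Act` is a set of names for the actions; the
outside option is `none : Option Act`. In step `j < steps`, the option `selected j` is selected. -/
structure DecisionProcess {X : Type*} [MeasurableSpace X] (B : BranchingBandit X) (Act : Type*)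
    [DecidableEq Act] where
  /-- the informational state of each action, from the moment it is available -/
  state : Act → X
  /-- the actions available at the start -/
  initial : Finset Act
  /-- the follow-up actions that an action reveals when selected -/
  children : Act → Finset Act
  /-- each follow-up action has a unique parent, and none is available at the start -/
  disjoint_children : ∀ a b, a ≠ b → Disjoint (children a) (children b)
  disjoint_initial : ∀ a, Disjoint initial (children a)
  /-- the number of steps -/
  steps : ℕ
  selected : ℕ → Option Act
  /-- the actions that are available in each step -/
  available : ℕ → Finset Act
  available_zero : available 0 = initial
  /-- A selected action leaves the choice set, its follow-up actions enter, the others stay. -/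
  available_succ : ∀ j a, j + 1 < steps → selected j = some a →
    available (j + 1) = (available j).erase a ∪ children a
  selected_mem : ∀ j a, j < steps → selected j = some a → a ∈ available j
  /-- Only the last step may take the outside option or select an action that ends the process. -/
  continues : ∀ j, j + 1 < steps → ∃ a, selected j = some a ∧ B.cont (state a) ≠ 0

namespace DecisionProcess

variable {X : Type*} [MeasurableSpace X] {B : BranchingBandit X} {Act : Type*} [DecidableEq Act]
  (P : DecisionProcess B Act)

/-- The choice set of step `j`: the available actions and the outside option. -/
def choiceSet (j : ℕ) : Finset (Option Act) := Finset.insertNone (P.available j)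

/-- The value of an action is its Gittins index; that of the outside option is its payoff `u₀`. -/
noncomputable def val (u₀ : ℝ) : Option Act → EReal
  | none => (u₀ : EReal)
  | some a => B.gittins (P.state a)

/-- The choice list of step `j` (in an arbitrary order). -/
noncomputable def choiceList (j : ℕ) : List X := (P.available j).toList.map P.state

/-- The position of an option in the choice list of step `j`; the outside option has none. -/
noncomputable def position (j : ℕ) : Option Act → ℕ
  | none => (P.available j).toList.length
  | some a => (P.available j).toList.idxOf a

/-- The process is optimal: the selection in every step is an optimal choice. -/
def IsOptimal (u₀ : ℝ) : Prop :=
  ∀ j, j < P.steps → B.IsOptimalChoice u₀ (P.choiceList j) (P.position j (P.selected j))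

/-- Step `j` is forward-accessible: some alternative of its choice set that is not selected in
step `j` is selected in a later step. -/
def ForwardAccessible (j : ℕ) : Prop :=
  ∃ o ∈ P.choiceSet j, o ≠ P.selected j ∧ ∃ k, j < k ∧ k < P.steps ∧ P.selected k = o

/-- `o` is available in some step of the process, and is selected in none. -/
def Unselected (o : Option Act) : Prop :=
  (∃ j, j < P.steps ∧ o ∈ P.choiceSet j) ∧ ∀ j, j < P.steps → P.selected j ≠ o

/-- The sub-core value of `o`: the minimum value of the options selected in forward-inaccessible
steps from the time on when `o` is available (a finite set of steps, which contains the last one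
if `o` becomes available in the course of the process). -/
noncomputable def subCoreValue (u₀ : ℝ) (o : Option Act) : EReal :=
  ⨅ j ∈ {j : ℕ | j < P.steps ∧ ¬ P.ForwardAccessible j ∧ ∃ i ≤ j, o ∈ P.choiceSet i},
    P.val u₀ (P.selected j)

end DecisionProcess

/-! The core is an index theorem: an option is an optimal choice if and only if no option of the
choice set has a higher value (`BranchingBandit.isOptimalChoice_iff`,
`BranchingBandit.isOptimalChoice_outside_iff`). Optimality of the process then says that every
selection has maximal value, and what remains is combinatorial. Unselected options stay available,
so maximality bounds them by their sub-core values; absence of ties makes the comparison with later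
selections strict. Conversely, let `o` be available in step `j`. If it is selected later, condition
1 applies. If it is never selected and step `j` is forward-inaccessible, the sub-core value of `o`
is at most the value selected in step `j`. If step `j` is forward-accessible, a later selection was
already available in step `j` and has a lower value, so the bound for that later step suffices
(`DecisionProcess.val_le_val_selected`).

The index theorem follows Whittle's retirement argument. As a function of the outside option `m`,
the value has as its slope the expected discount factor at retirement, a nondecreasing function `q`
with values in `[0, 1]`; hence the excess of the value over `m` is the integral of `1 - q` over `(m,
∞)`, here `shortfall q m`. Since actions evolve independently, the curve of a list is the product of
the curves of its actions. Selecting one action first loses an explicit amount against this product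
formula (`exists_selectionLoss_eq`): never negative, zero for an action with the highest threshold,
and bounded below if the action is worse than stopping or than another action.

To make the recursion well-founded, each action carries a number of generations that may still be
selected. Unlike a bound on the number of selections, this truncation treats the actions separately
and keeps the product formula. The two truncations have the same limit: `excess_le_indexExcess` and
`indexExcess_le_iSup`. Letting the number of generations grow, a choice is optimal if and only if
its loss tends to zero (`isOptimalChoice_iff_tendsto`). That the loss does not vanish for an
inferior action requires a strictly negative net gain beyond the Gittins index (`limitGain_neg`);
this is where costly actions and the boundary condition enter. -/

section ListMeasurability

/-! ### Measurability on spaces of finite lists -/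

theorem listToSigma_ofFn {α : Type*} {n : ℕ} (v : Fin n → α) :
    (⟨(List.ofFn v).length, (List.ofFn v).get⟩ : Σ n : ℕ, (Fin n → α)) = ⟨n, v⟩ :=
  List.equivSigmaTuple.right_inv ⟨n, v⟩

variable {α β γ : Type*} [MeasurableSpace α] [MeasurableSpace β] [MeasurableSpace γ]

theorem measurableSet_sigma_iff {ι : Type*} {δ : ι → Type*} [∀ i, MeasurableSpace (δ i)]
    {s : Set (Sigma δ)} : MeasurableSet s ↔ ∀ i, MeasurableSet (Sigma.mk i ⁻¹' s) := by
  change MeasurableSet[⨅ i, MeasurableSpace.map (Sigma.mk i) inferInstance] s ↔ _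
  rw [MeasurableSpace.measurableSet_iInf]
  rfl

theorem measurable_sigma_mk' {ι : Type*} {δ : ι → Type*} [∀ i, MeasurableSpace (δ i)] (i : ι) :
    Measurable (Sigma.mk i : δ i → Sigma δ) :=
  fun _ hs => measurableSet_sigma_iff.1 hs i

theorem measurable_listOfFn (n : ℕ) : Measurable (List.ofFn : (Fin n → α) → List α) := by
  refine measurable_comap_iff.2 ?_
  have : ((fun l : List α => (⟨l.length, l.get⟩ : Σ n : ℕ, (Fin n → α))) ∘ List.ofFn) =
      fun v => (⟨n, v⟩ : Σ n : ℕ, (Fin n → α)) := by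
    funext v
    exact listToSigma_ofFn v
  rw [this]
  exact measurable_sigma_mk' (δ := fun n : ℕ => Fin n → α) n

/-- Lists are the countable disjoint union of the spaces of tuples. Measurable images, not only
measurable preimages, are needed to reassemble a set of lists from its fixed-length pieces. -/
theorem measurableEmbedding_listOfFn (n : ℕ) :
    MeasurableEmbedding (List.ofFn : (Fin n → α) → List α) where
  injective := List.ofFn_injective
  measurable := measurable_listOfFn n
  measurableSet_image' := by
    intro A hA
    refine ⟨(fun v => (⟨n, v⟩ : Σ n : ℕ, (Fin n → α))) '' A, measurableSet_sigma_iff.2 fun m => ?_, ?_⟩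
    · by_cases h : m = n
      · subst h
        rwa [Set.preimage_image_eq _ sigma_mk_injective]
      · convert MeasurableSet.empty
        ext v
        simp only [Set.mem_preimage, Set.mem_image, Set.mem_empty_iff_false, iff_false]
        rintro ⟨w, -, hw⟩
        exact h (congrArg Sigma.fst hw).symm
    · ext l
      obtain ⟨⟨k, v⟩, rfl⟩ := List.equivSigmaTuple.symm.surjective l
      simp only [Set.mem_preimage, List.equivSigmaTuple, Equiv.coe_fn_symm_mk, listToSigma_ofFn,
        Set.mem_image]
      constructor
      · rintro ⟨w, hw, h⟩
        cases h
        exact ⟨_, hw, rfl⟩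
      · rintro ⟨w, hw, h⟩
        refine ⟨w, hw, ?_⟩
        rw [← listToSigma_ofFn w, ← listToSigma_ofFn v, h]

/-- Measurability of a function of a list and a parameter can be checked on tuples. -/
theorem measurable_of_listOfFn_prod {F : List α × γ → β}
    (h : ∀ n, Measurable fun p : (Fin n → α) × γ => F (List.ofFn p.1, p.2)) : Measurable F := by
  intro S hS
  have : F ⁻¹' S = ⋃ n : ℕ, Prod.map (List.ofFn : (Fin n → α) → List α) (id : γ → γ) ''
      ((fun p : (Fin n → α) × γ => F (List.ofFn p.1, p.2)) ⁻¹' S) := by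
    ext ⟨l, c⟩
    simp only [Set.mem_preimage, Set.mem_iUnion, Set.mem_image, Prod.exists, Prod.map_apply, id_eq,
      Prod.mk.injEq]
    constructor
    · intro hl
      exact ⟨l.length, l.get, c, by rwa [List.ofFn_get], List.ofFn_get l, rfl⟩
    · rintro ⟨n, v, c', hv, rfl, rfl⟩
      exact hv
  rw [this]
  exact MeasurableSet.iUnion fun n =>
    ((measurableEmbedding_listOfFn n).prodMap MeasurableEmbedding.id).measurableSet_image.2
      (h n hS)

theorem measurable_of_listOfFn {F : List α → β}
    (h : ∀ n, Measurable fun v : Fin n → α => F (List.ofFn v)) : Measurable F := by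
  have : Measurable fun p : List α × Unit => F p.1 :=
    measurable_of_listOfFn_prod fun n => (h n).comp measurable_fst
  exact this.comp (measurable_id.prodMk (measurable_const (a := ())))

theorem measurable_list_length : Measurable (List.length : List α → ℕ) :=
  measurable_of_listOfFn fun n => by simp

theorem measurable_list_append : Measurable fun p : List α × List α => p.1 ++ p.2 := by
  refine measurable_of_listOfFn_prod fun n => ?_
  have : Measurable fun p : List α × (Fin n → α) => List.ofFn p.2 ++ p.1 := by
    refine measurable_of_listOfFn_prod fun m => ?_
    simp_rw [← List.ofFn_fin_append]
    refine (measurable_listOfFn _).comp (measurable_pi_lambda _ fun i => ?_)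
    refine Fin.addCases (fun j => ?_) (fun j => ?_) i
    · simpa [Function.comp_def] using (measurable_pi_apply j).comp measurable_snd
    · simpa [Function.comp_def] using (measurable_pi_apply j).comp measurable_fst
  exact this.comp measurable_swap

theorem measurable_list_cons : Measurable fun p : α × List α => p.1 :: p.2 := by
  have : Measurable fun p : List α × α => p.2 :: p.1 := by
    refine measurable_of_listOfFn_prod fun m => ?_
    have h : ∀ p : (Fin m → α) × α, p.2 :: List.ofFn p.1 =
        List.ofFn (Fin.cons p.2 p.1 : Fin (m + 1) → α) := fun p => by simp
    simp_rw [h]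
    refine (measurable_listOfFn _).comp (measurable_pi_lambda _ fun i => ?_)
    refine Fin.cases ?_ (fun j => ?_) i
    · simpa using measurable_snd
    · simpa [Function.comp_def] using (measurable_pi_apply j).comp measurable_fst
  exact this.comp measurable_swap

theorem measurable_list_eraseIdx (i : ℕ) : Measurable fun l : List α => l.eraseIdx i := by
  refine measurable_of_listOfFn fun n => ?_
  by_cases hi : i < n
  · obtain ⟨m, rfl⟩ : ∃ m, n = m + 1 := ⟨n - 1, by omega⟩
    have h : ∀ v : Fin (m + 1) → α, (List.ofFn v).eraseIdx i =
        List.ofFn (fun j : Fin m => v (Fin.succAbove ⟨i, hi⟩ j)) := by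
      intro v
      apply List.ext_getElem
      · simp [List.length_eraseIdx, hi]
      · intro k h1 h2
        simp only [List.getElem_eraseIdx, List.getElem_ofFn, Fin.succAbove, Fin.lt_def,
          Fin.val_castSucc]
        split_ifs <;> rfl
    simp_rw [h]
    exact (measurable_listOfFn _).comp (measurable_pi_lambda _ fun j => measurable_pi_apply _)
  · have h : ∀ v : Fin n → α, (List.ofFn v).eraseIdx i = List.ofFn v := fun v =>
      List.eraseIdx_of_length_le (by simpa using hi)
    simp_rw [h]
    exact measurable_listOfFn n

/-- A measurable function of the `i`-th entry, the list and a parameter. -/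
theorem Measurable.dite_list_getElem {F : α → List α × γ → β} (hF : Measurable (Function.uncurry F))
    {G : List α × γ → β} (hG : Measurable G) (i : ℕ) :
    Measurable fun p : List α × γ => if h : i < p.1.length then F p.1[i] p else G p := by
  refine measurable_of_listOfFn_prod fun n => ?_
  have hm : Measurable fun p : (Fin n → α) × γ => (List.ofFn p.1, p.2) :=
    ((measurable_listOfFn n).comp measurable_fst).prodMk measurable_snd
  by_cases hi : i < n
  · have h : ∀ p : (Fin n → α) × γ, (if h : i < (List.ofFn p.1).length then
        F (List.ofFn p.1)[i] (List.ofFn p.1, p.2) else G (List.ofFn p.1, p.2)) =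
        F (p.1 ⟨i, hi⟩) (List.ofFn p.1, p.2) := fun p => by simp [hi]
    simp only [h]
    exact hF.comp (((measurable_pi_apply _).comp measurable_fst).prodMk hm)
  · have h : ∀ p : (Fin n → α) × γ, (if h : i < (List.ofFn p.1).length then
        F (List.ofFn p.1)[i] (List.ofFn p.1, p.2) else G (List.ofFn p.1, p.2)) =
        G (List.ofFn p.1, p.2) := fun p => by simp [hi]
    simp only [h]
    exact hG.comp hm

theorem measurable_list_map_prod {f : α → γ → ℝ} (hf : Measurable (Function.uncurry f)) :
    Measurable fun p : List α × γ => (p.1.map fun y => f y p.2).prod := by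
  refine measurable_of_listOfFn_prod fun n => ?_
  simp only [List.map_ofFn, List.prod_ofFn]
  refine Finset.measurable_prod _ fun i _ => ?_
  have h : Measurable fun p : (Fin n → α) × γ => (p.1 i, p.2) :=
    ((measurable_pi_apply i).comp measurable_fst).prodMk measurable_snd
  exact hf.comp h

end ListMeasurability

/-! ### Calculus of retirement curves -/

section RetirementCurve

open Set

/-- A nondecreasing function with values in `[0, 1]` whose distance from `1` is integrable at
infinity: as a function of the outside option, the expected discount factor at retirement. -/
structure IsRetirementCurve (q : ℝ → ℝ) : Prop where
  mono : Monotone q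
  nonneg : ∀ t, 0 ≤ q t
  le_one : ∀ t, q t ≤ 1
  integrable : ∀ m, IntegrableOn (fun t => 1 - q t) (Ioi m)

/-- The excess of the value over the outside option `m` that a retirement curve stands for. -/
noncomputable def shortfall (q : ℝ → ℝ) (m : ℝ) : ℝ := ∫ t in Ioi m, (1 - q t)

theorem isRetirementCurve_one : IsRetirementCurve fun _ => 1 where
  mono := monotone_const
  nonneg _ := zero_le_one
  le_one _ := le_rfl
  integrable m := by simp

theorem shortfall_one (m : ℝ) : shortfall (fun _ => 1) m = 0 := by simp [shortfall]

namespace IsRetirementCurve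

variable {p q P : ℝ → ℝ}

theorem measurable (hq : IsRetirementCurve q) : Measurable q := hq.mono.measurable

theorem one_sub_nonneg (hq : IsRetirementCurve q) (t : ℝ) : 0 ≤ 1 - q t :=
  sub_nonneg.2 (hq.le_one t)

theorem shortfall_nonneg (hq : IsRetirementCurve q) (m : ℝ) : 0 ≤ shortfall q m :=
  integral_nonneg hq.one_sub_nonneg

theorem ofReal_shortfall (hq : IsRetirementCurve q) (m : ℝ) :
    ENNReal.ofReal (shortfall q m) = ∫⁻ t in Ioi m, ENNReal.ofReal (1 - q t) :=
  ofReal_integral_eq_lintegral_ofReal (hq.integrable m) (ae_of_all _ hq.one_sub_nonneg)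

theorem integrableOn_Ioc (hq : IsRetirementCurve q) (a b : ℝ) :
    IntegrableOn (fun t => 1 - q t) (Ioc a b) :=
  (hq.integrable a).mono_set Ioc_subset_Ioi_self

theorem shortfall_sub (hq : IsRetirementCurve q) {a b : ℝ} (hab : a ≤ b) :
    shortfall q a - shortfall q b = ∫ t in Ioc a b, (1 - q t) := by
  have h : Ioi a = Ioc a b ∪ Ioi b := (Ioc_union_Ioi_eq_Ioi hab).symm
  rw [shortfall, shortfall, h, setIntegral_union (Ioc_disjoint_Ioi le_rfl) measurableSet_Ioi
    (hq.integrableOn_Ioc a b) (hq.integrable b)]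
  ring

theorem integral_Ioc_le (hq : IsRetirementCurve q) {a b : ℝ} (hab : a ≤ b) :
    ∫ t in Ioc a b, (1 - q t) ≤ (b - a) * (1 - q a) := by
  have h : ∫ t in Ioc a b, (1 - q t) ≤ ∫ _ in Ioc a b, (1 - q a) :=
    setIntegral_mono_on (hq.integrableOn_Ioc a b) (by simp) measurableSet_Ioc fun t ht => by
      linarith [hq.mono ht.1.le]
  simpa [hab] using h

theorem le_integral_Ioc (hq : IsRetirementCurve q) {a b : ℝ} (hab : a ≤ b) :
    (b - a) * (1 - q b) ≤ ∫ t in Ioc a b, (1 - q t) := by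
  have h : ∫ _ in Ioc a b, (1 - q b) ≤ ∫ t in Ioc a b, (1 - q t) :=
    setIntegral_mono_on (by simp) (hq.integrableOn_Ioc a b) measurableSet_Ioc fun t ht => by
      linarith [hq.mono ht.2]
  simpa [hab] using h

theorem shortfall_sub_le (hq : IsRetirementCurve q) {a b : ℝ} (hab : a ≤ b) :
    shortfall q a - shortfall q b ≤ (b - a) * (1 - q a) :=
  (hq.shortfall_sub hab).trans_le (hq.integral_Ioc_le hab)

theorem le_shortfall_sub (hq : IsRetirementCurve q) {a b : ℝ} (hab : a ≤ b) :
    (b - a) * (1 - q b) ≤ shortfall q a - shortfall q b :=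
  (hq.le_integral_Ioc hab).trans_eq (hq.shortfall_sub hab).symm

theorem shortfall_antitone (hq : IsRetirementCurve q) : Antitone (shortfall q) := fun a b hab => by
  have := hq.le_shortfall_sub hab
  nlinarith [hq.le_one b]

theorem tendsto_shortfall (hq : IsRetirementCurve q) :
    Filter.Tendsto (shortfall q) Filter.atTop (nhds 0) := by
  have h : ∀ b, 0 ≤ b → shortfall q b = shortfall q 0 - ∫ t in (0 : ℝ)..b, (1 - q t) := by
    intro b hb
    rw [intervalIntegral.integral_of_le hb, ← hq.shortfall_sub hb]
    ring
  have h2 := intervalIntegral_tendsto_integral_Ioi 0 (hq.integrable 0) Filter.tendsto_id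
  have h3 := h2.const_sub (shortfall q 0)
  rw [← shortfall, sub_self] at h3
  refine h3.congr' ?_
  filter_upwards [Filter.eventually_ge_atTop 0] with b hb
  rw [h b hb, id]

theorem mul (hp : IsRetirementCurve p) (hq : IsRetirementCurve q) :
    IsRetirementCurve fun t => p t * q t where
  mono a b hab := mul_le_mul (hp.mono hab) (hq.mono hab) (hq.nonneg a) (hp.nonneg b)
  nonneg t := mul_nonneg (hp.nonneg t) (hq.nonneg t)
  le_one t := mul_le_one₀ (hp.le_one t) (hq.nonneg t) (hq.le_one t)
  integrable m := by
    refine Integrable.mono' ((hp.integrable m).add (hq.integrable m))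
      (measurable_const.sub (hp.measurable.mul hq.measurable)).aestronglyMeasurable
      (ae_of_all _ fun t => ?_)
    have h1 := hp.nonneg t
    have h2 := hp.le_one t
    have h3 := hq.nonneg t
    have h4 := hq.le_one t
    rw [Real.norm_of_nonneg (by nlinarith)]
    simp only [Pi.add_apply]
    nlinarith

/-- Pointwise, `1 - p * q ≤ (1 - p) + (1 - q)`. This gives finite bounds for lists from bounds for
single actions. -/
theorem shortfall_mul_le (hp : IsRetirementCurve p) (hq : IsRetirementCurve q) (m : ℝ) :
    shortfall (fun t => p t * q t) m ≤ shortfall p m + shortfall q m := by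
  unfold shortfall
  rw [← integral_add (hp.integrable m) (hq.integrable m)]
  refine integral_mono ((hp.mul hq).integrable m) ((hp.integrable m).add (hq.integrable m))
    fun t => ?_
  have h2 := hp.le_one t
  have h4 := hq.le_one t
  simp only
  nlinarith

theorem shortfall_eq_zero (h : ∀ t, m < t → q t = 1) : shortfall q m = 0 := by
  rw [shortfall, setIntegral_congr_fun (g := fun _ => 0) measurableSet_Ioi fun t ht => by
    simp [h t ht]]
  simp

/-- A retirement curve without shortfall beyond `m` equals one there. -/
theorem eq_one_of_shortfall (hq : IsRetirementCurve q) {m : ℝ} (h : shortfall q m = 0) {t : ℝ}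
    (ht : m < t) : q t = 1 := by
  have h1 := hq.le_shortfall_sub ht.le
  have h2 := hq.shortfall_nonneg t
  have h3 := hq.le_one t
  nlinarith [sub_pos.2 ht]

end IsRetirementCurve

/-- Net gain from a first action with mean payoff `ρ` and continuation factor `δ`, whose follow-up
actions have the mean retirement curve `P`, when the outside option is `c`. -/
noncomputable def netGain (ρ δ : ℝ) (P : ℝ → ℝ) (c : ℝ) : ℝ := ρ + δ * (c + shortfall P c) - c

/-- Retirement curve of an action whose follow-up actions have the mean retirement curve `P`. -/
noncomputable def stepCurve (ρ δ : ℝ) (P : ℝ → ℝ) (c : ℝ) : ℝ :=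
  if 0 < netGain ρ δ P c then δ * P c else 1

/-- Loss from selecting an action first, when the other available actions have the joint retirement
curve `q`. -/
noncomputable def selectionLoss (ρ δ : ℝ) (P q : ℝ → ℝ) (m : ℝ) : ℝ :=
  shortfall (fun t => stepCurve ρ δ P t * q t) m -
    (ρ + δ * (m + shortfall (fun t => P t * q t) m) - m)

/-! ### Net gain and loss from selecting one action first -/

section Step

variable {ρ δ : ℝ} {P q : ℝ → ℝ}

/-- The net gain falls at rate `1 - δ * P t`. As `P` is nondecreasing, this makes it convex and
1-Lipschitz in the outside option. -/
theorem netGain_sub (hP : IsRetirementCurve P) {a b : ℝ} (hab : a ≤ b) :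
    netGain ρ δ P a - netGain ρ δ P b = ∫ t in Ioc a b, (1 - δ * P t) := by
  have h : ∫ t in Ioc a b, (1 - δ * P t) =
      ∫ t in Ioc a b, ((1 - δ) + δ * (1 - P t)) := by
    congr 1
    ext t
    ring
  rw [h, integral_add (by simp) ((hP.integrableOn_Ioc a b).const_mul δ), integral_const_mul,
    ← hP.shortfall_sub hab]
  simp only [netGain, integral_const, measureReal_restrict_apply_univ, Real.volume_real_Ioc_of_le
    hab, smul_eq_mul]
  ring

theorem netGain_sub_le (hP : IsRetirementCurve P) (h0 : 0 ≤ δ) {a b : ℝ} (hab : a ≤ b) :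
    netGain ρ δ P a - netGain ρ δ P b ≤ (b - a) * (1 - δ * P a) := by
  have h := mul_le_mul_of_nonneg_left (hP.shortfall_sub_le hab) h0
  simp only [netGain]
  linarith

theorem le_netGain_sub (hP : IsRetirementCurve P) (h0 : 0 ≤ δ) {a b : ℝ} (hab : a ≤ b) :
    (b - a) * (1 - δ * P b) ≤ netGain ρ δ P a - netGain ρ δ P b := by
  have h := mul_le_mul_of_nonneg_left (hP.le_shortfall_sub hab) h0
  simp only [netGain]
  linarith

theorem one_sub_mul_nonneg (hP : IsRetirementCurve P) (h0 : 0 ≤ δ) (h1 : δ ≤ 1) (t : ℝ) :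
    0 ≤ 1 - δ * P t := by
  nlinarith [hP.le_one t, hP.nonneg t]

theorem netGain_antitone (hP : IsRetirementCurve P) (h0 : 0 ≤ δ) (h1 : δ ≤ 1) :
    Antitone (netGain ρ δ P) := fun a b hab => by
  have h := le_netGain_sub (ρ := ρ) hP h0 hab
  nlinarith [one_sub_mul_nonneg hP h0 h1 b]

theorem netGain_sub_le_sub (hP : IsRetirementCurve P) (h0 : 0 ≤ δ) {a b : ℝ} (hab : a ≤ b) :
    netGain ρ δ P a - netGain ρ δ P b ≤ b - a := by
  have h := netGain_sub_le (ρ := ρ) hP h0 hab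
  nlinarith [mul_nonneg h0 (hP.nonneg a), sub_nonneg.2 hab]

theorem netGain_continuous (hP : IsRetirementCurve P) (h0 : 0 ≤ δ) (h1 : δ ≤ 1) :
    Continuous (netGain ρ δ P) := by
  refine (LipschitzWith.of_le_add_mul 1 fun a b => ?_).continuous
  rcases le_total a b with hab | hab
  · have := netGain_sub_le_sub (ρ := ρ) hP h0 hab
    rw [Real.dist_eq, abs_sub_comm, abs_of_nonneg (sub_nonneg.2 hab)]
    push_cast
    linarith
  · have := netGain_antitone (ρ := ρ) hP h0 h1 hab
    have := dist_nonneg (x := a) (y := b)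
    push_cast
    linarith

/-- The net gain of a costly action is negative at high outside options. -/
theorem exists_netGain_nonpos (hP : IsRetirementCurve P) (h1 : δ ≤ 1)
    (h : δ < 1 ∨ ρ < 0) : ∃ b, netGain ρ δ P b ≤ 0 := by
  by_cases hδ : δ < 1
  · refine ⟨max 0 ((ρ + shortfall P 0) / (1 - δ)), ?_⟩
    set b := max 0 ((ρ + shortfall P 0) / (1 - δ))
    have h2 : shortfall P b ≤ shortfall P 0 := hP.shortfall_antitone (le_max_left _ _)
    have h3 : ρ + shortfall P 0 ≤ b * (1 - δ) :=
      (div_le_iff₀ (sub_pos.2 hδ)).1 (le_max_right _ _)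
    have h4 := hP.shortfall_nonneg b
    simp only [netGain]
    nlinarith
  -- Without discounting, the vanishing shortfall is eventually outweighed by the negative mean
  -- payoff.
  · have hρ := h.resolve_left hδ
    have hlim := (hP.tendsto_shortfall.const_mul δ)
    rw [mul_zero] at hlim
    obtain ⟨b, hb, hb0⟩ := ((hlim.eventually (gt_mem_nhds (neg_pos.2 hρ))).and
      (Filter.eventually_ge_atTop 0)).exists
    refine ⟨b, ?_⟩
    simp only [netGain]
    nlinarith

/-- The least outside option from `m` on at which stopping is optimal. -/
theorem exists_threshold (hP : IsRetirementCurve P) (h0 : 0 ≤ δ) (h1 : δ ≤ 1)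
    (h : δ < 1 ∨ ρ < 0) (m : ℝ) :
    ∃ g, m ≤ g ∧ netGain ρ δ P g ≤ 0 ∧ (g = m ∨ netGain ρ δ P g = 0) ∧
      ∀ t, m ≤ t → t < g → 0 < netGain ρ δ P t := by
  have hcont := netGain_continuous (ρ := ρ) hP h0 h1
  have hanti := netGain_antitone (ρ := ρ) hP h0 h1
  by_cases hm : netGain ρ δ P m ≤ 0
  · exact ⟨m, le_rfl, hm, Or.inl rfl, fun t h1 h2 => absurd h1 (not_le.2 h2)⟩
  obtain ⟨b, hb⟩ := exists_netGain_nonpos hP h1 h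
  have hmb : m ≤ b := by
    by_contra hlt
    exact hm ((hanti (not_le.1 hlt).le).trans hb)
  obtain ⟨z, hz, hz0⟩ := intermediate_value_Icc' hmb hcont.continuousOn ⟨hb, (not_le.1 hm).le⟩
  set S := {t | m ≤ t ∧ netGain ρ δ P t ≤ 0}
  have hS : IsClosed S :=
    (isClosed_le continuous_const continuous_id).inter (isClosed_le hcont continuous_const)
  have hbdd : BddBelow S := ⟨m, fun t ht => ht.1⟩
  have hmem : sInf S ∈ S := hS.csInf_mem ⟨b, hmb, hb⟩ hbdd
  refine ⟨sInf S, hmem.1, hmem.2, Or.inr (le_antisymm hmem.2 ?_), fun t ht htS => ?_⟩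
  · rw [← hz0]
    exact hanti (csInf_le hbdd ⟨hz.1, hz0.le⟩)
  · by_contra hle
    exact absurd (csInf_le hbdd ⟨ht, not_lt.1 hle⟩) (not_le.2 htS)

theorem stepCurve_eq_one (hP : IsRetirementCurve P) (h0 : 0 ≤ δ) (h1 : δ ≤ 1) {g t : ℝ}
    (hg : netGain ρ δ P g ≤ 0) (ht : g ≤ t) : stepCurve ρ δ P t = 1 :=
  if_neg (not_lt.2 ((netGain_antitone hP h0 h1 ht).trans hg))

/-- The net gain is antitone, so the branch `δ * P`, which is nondecreasing and at most one,
precedes the branch `1`. -/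
theorem IsRetirementCurve.step (hP : IsRetirementCurve P) (h0 : 0 ≤ δ) (h1 : δ ≤ 1)
    (h : δ < 1 ∨ ρ < 0) : IsRetirementCurve (stepCurve ρ δ P) := by
  have hle : ∀ t, δ * P t ≤ 1 := fun t => sub_nonneg.1 (one_sub_mul_nonneg hP h0 h1 t)
  have hmono : Monotone (stepCurve ρ δ P) := by
    intro a b hab
    unfold stepCurve
    by_cases hb : 0 < netGain ρ δ P b
    · rw [if_pos hb, if_pos (hb.trans_le (netGain_antitone hP h0 h1 hab))]
      exact mul_le_mul_of_nonneg_left (hP.mono hab) h0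
    · rw [if_neg hb]
      split_ifs
      exacts [hle a, le_rfl]
  have hnonneg : ∀ t, 0 ≤ stepCurve ρ δ P t := fun t => by
    unfold stepCurve
    split_ifs
    exacts [mul_nonneg h0 (hP.nonneg t), zero_le_one]
  have hle_one : ∀ t, stepCurve ρ δ P t ≤ 1 := fun t => by
    unfold stepCurve
    split_ifs
    exacts [hle t, le_rfl]
  refine ⟨hmono, hnonneg, hle_one, fun m => ?_⟩
  obtain ⟨g, hmg, hg, -, -⟩ := exists_threshold hP h0 h1 h m
  rw [← Ioc_union_Ioi_eq_Ioi hmg]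
  refine IntegrableOn.union ?_ ?_
  · refine Measure.integrableOn_of_bounded (M := 1) (by simp)
      (measurable_const.sub hmono.measurable).aestronglyMeasurable (ae_of_all _ fun t => ?_)
    rw [Real.norm_of_nonneg (sub_nonneg.2 (hle_one t))]
    linarith [hnonneg t]
  · refine (integrableOn_congr_fun (g := fun _ => 0) (fun t ht => ?_) measurableSet_Ioi).2
      (by simp)
    simp [stepCurve_eq_one hP h0 h1 hg (le_of_lt ht)]

theorem shortfall_stepCurve_mul (hP : IsRetirementCurve P) (hq : IsRetirementCurve q) (h0 : 0 ≤ δ)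
    (h1 : δ ≤ 1) (h : δ < 1 ∨ ρ < 0) {m g : ℝ} (hmg : m ≤ g) (hg : netGain ρ δ P g ≤ 0)
    (hpos : ∀ t, m ≤ t → t < g → 0 < netGain ρ δ P t) :
    shortfall (fun t => stepCurve ρ δ P t * q t) m =
      (∫ t in Ioc m g, (1 - δ * (P t * q t))) + shortfall q g := by
  have hpq := (hP.step h0 h1 h).mul hq
  have hsplit := hpq.shortfall_sub hmg
  have htail : shortfall (fun t => stepCurve ρ δ P t * q t) g = shortfall q g :=
    setIntegral_congr_fun measurableSet_Ioi fun t ht => by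
      simp [stepCurve_eq_one hP h0 h1 hg (le_of_lt ht)]
  have hbody : ∫ t in Ioc m g, (1 - stepCurve ρ δ P t * q t) =
      ∫ t in Ioc m g, (1 - δ * (P t * q t)) := by
    rw [integral_Ioc_eq_integral_Ioo, integral_Ioc_eq_integral_Ioo]
    refine setIntegral_congr_fun measurableSet_Ioo fun t ht => ?_
    simp only [stepCurve, if_pos (hpos t ht.1.le ht.2)]
    ring
  rw [← hbody, ← htail, ← hsplit]
  ring

/-- This is the Bellman equation of a single action with the choice between stopping and selecting
it; it justifies the definition of `stepCurve`. Both sides are the integral of the slope of the net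
gain from `m` to the threshold. -/
theorem shortfall_stepCurve (hP : IsRetirementCurve P) (h0 : 0 ≤ δ) (h1 : δ ≤ 1)
    (h : δ < 1 ∨ ρ < 0) (m : ℝ) :
    shortfall (stepCurve ρ δ P) m = max (netGain ρ δ P m) 0 := by
  obtain ⟨g, hmg, hg, hg', hpos⟩ := exists_threshold hP h0 h1 h m
  have key := shortfall_stepCurve_mul hP isRetirementCurve_one h0 h1 h hmg hg hpos
  simp only [mul_one, shortfall_one, add_zero] at key
  rw [show shortfall (stepCurve ρ δ P) m = _ from key, ← netGain_sub (ρ := ρ) hP hmg]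
  rcases hg' with rfl | hg0
  · rw [max_eq_right hg, sub_self]
  · rw [hg0, sub_zero]
    rw [max_eq_left]
    exact hg0.ge.trans (netGain_antitone hP h0 h1 hmg)

/-- The loss from selecting an action first is its negative net gain at the least acceptable outside
option, plus the gains of the other actions beyond it. -/
theorem exists_selectionLoss_eq (hP : IsRetirementCurve P) (hq : IsRetirementCurve q) (h0 : 0 ≤ δ)
    (h1 : δ ≤ 1) (h : δ < 1 ∨ ρ < 0) (m : ℝ) :
    ∃ g, m ≤ g ∧ netGain ρ δ P g ≤ 0 ∧ (g = m ∨ netGain ρ δ P g = 0) ∧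
      selectionLoss ρ δ P q m =
        -netGain ρ δ P g + ∫ t in Ioi g, (1 - q t) * (1 - δ * P t) ∧
      IntegrableOn (fun t => (1 - q t) * (1 - δ * P t)) (Ioi g) := by
  obtain ⟨g, hmg, hg, hg', hpos⟩ := exists_threshold hP h0 h1 h m
  have hint : ∀ a, IntegrableOn (fun t => P t * (1 - q t)) (Ioi a) := fun a => by
    refine (((hP.mul hq).integrable a).sub (hP.integrable a)).congr (ae_of_all _ fun t => ?_)
    simp only [Pi.sub_apply]
    ring
  have hint' : IntegrableOn (fun t => (1 - q t) * (1 - δ * P t)) (Ioi g) := by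
    refine ((hq.integrable g).sub ((hint g).const_mul δ)).congr (ae_of_all _ fun t => ?_)
    simp only [Pi.sub_apply]
    ring
  refine ⟨g, hmg, hg, hg', ?_, hint'⟩
  have e1 : shortfall (fun t => P t * q t) m - shortfall P m = ∫ t in Ioi m, P t * (1 - q t) := by
    unfold shortfall
    rw [← integral_sub ((hP.mul hq).integrable m) (hP.integrable m)]
    congr 1
    ext t
    ring
  have e2 : ∫ t in Ioi m, P t * (1 - q t) =
      (∫ t in Ioc m g, P t * (1 - q t)) + ∫ t in Ioi g, P t * (1 - q t) := by
    rw [← setIntegral_union (Ioc_disjoint_Ioi le_rfl) measurableSet_Ioi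
      ((hint m).mono_set Ioc_subset_Ioi_self) (hint g), Ioc_union_Ioi_eq_Ioi hmg]
  have e3 : ∫ t in Ioc m g, (1 - δ * (P t * q t)) =
      (∫ t in Ioc m g, (1 - δ * P t)) + δ * ∫ t in Ioc m g, P t * (1 - q t) := by
    rw [← integral_const_mul, ← integral_add]
    · congr 1
      ext t
      ring
    · refine ((integrableOn_const (C := 1 - δ) (by simp)).add
        ((hP.integrableOn_Ioc m g).const_mul δ)).congr (ae_of_all _ fun t => ?_)
      simp only [Pi.add_apply]
      ring
    · exact ((hint m).mono_set Ioc_subset_Ioi_self).const_mul δ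
  have e4 : ∫ t in Ioi g, (1 - q t) * (1 - δ * P t) =
      shortfall q g - δ * ∫ t in Ioi g, P t * (1 - q t) := by
    rw [shortfall, ← integral_const_mul, ← integral_sub (hq.integrable g) ((hint g).const_mul δ)]
    congr 1
    ext t
    ring
  have e5 := netGain_sub (ρ := ρ) (δ := δ) hP hmg
  have e6 : ρ + δ * (m + shortfall (fun t => P t * q t) m) - m =
      netGain ρ δ P m + δ * (shortfall (fun t => P t * q t) m - shortfall P m) := by
    simp only [netGain]
    ring
  rw [selectionLoss, shortfall_stepCurve_mul hP hq h0 h1 h hmg hg hpos, e6, e1, e2, e3, e4, ← e5]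
  ring

theorem selectionLoss_nonneg (hP : IsRetirementCurve P) (hq : IsRetirementCurve q) (h0 : 0 ≤ δ)
    (h1 : δ ≤ 1) (h : δ < 1 ∨ ρ < 0) (m : ℝ) : 0 ≤ selectionLoss ρ δ P q m := by
  obtain ⟨g, -, hg, -, hD, -⟩ := exists_selectionLoss_eq hP hq h0 h1 h m
  rw [hD]
  have : 0 ≤ ∫ t in Ioi g, (1 - q t) * (1 - δ * P t) :=
    integral_nonneg fun t => mul_nonneg (hq.one_sub_nonneg t) (one_sub_mul_nonneg hP h0 h1 t)
  linarith

theorem neg_netGain_le_selectionLoss (hP : IsRetirementCurve P) (hq : IsRetirementCurve q)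
    (h0 : 0 ≤ δ) (h1 : δ ≤ 1) (h : δ < 1 ∨ ρ < 0) (m : ℝ) :
    -netGain ρ δ P m ≤ selectionLoss ρ δ P q m := by
  obtain ⟨g, hmg, hg, -, hD, -⟩ := exists_selectionLoss_eq hP hq h0 h1 h m
  rw [hD]
  have : 0 ≤ ∫ t in Ioi g, (1 - q t) * (1 - δ * P t) :=
    integral_nonneg fun t => mul_nonneg (hq.one_sub_nonneg t) (one_sub_mul_nonneg hP h0 h1 t)
  linarith [netGain_antitone (ρ := ρ) hP h0 h1 hmg]

/-- Up to `b` the factor `1 - q` is at least `1 - q b`, so the integral in the loss formula is at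
least that multiple of the drop of the net gain from the threshold to `b`. The bound detects another
action that is still worth selecting at an outside option `b` at which this one is not. -/
theorem mul_neg_netGain_le_selectionLoss (hP : IsRetirementCurve P) (hq : IsRetirementCurve q)
    (h0 : 0 ≤ δ) (h1 : δ ≤ 1) (h : δ < 1 ∨ ρ < 0) (m b : ℝ) :
    (1 - q b) * -netGain ρ δ P b ≤ selectionLoss ρ δ P q m := by
  obtain ⟨g, hmg, hg, hg', hD, hint⟩ := exists_selectionLoss_eq hP hq h0 h1 h m
  have hq1 := hq.one_sub_nonneg b
  have hq2 := hq.nonneg b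
  have hnn : ∀ t, 0 ≤ (1 - q t) * (1 - δ * P t) := fun t =>
    mul_nonneg (hq.one_sub_nonneg t) (one_sub_mul_nonneg hP h0 h1 t)
  rw [hD]
  rcases le_or_gt b g with hbg | hgb
  · have h2 : 0 ≤ ∫ t in Ioi g, (1 - q t) * (1 - δ * P t) := integral_nonneg hnn
    have h3 := netGain_antitone (ρ := ρ) hP h0 h1 hbg
    nlinarith
  · have h2 : ∫ t in Ioc g b, (1 - q t) * (1 - δ * P t) ≤
        ∫ t in Ioi g, (1 - q t) * (1 - δ * P t) :=
      setIntegral_mono_set hint (ae_of_all _ hnn) (ae_of_all _ fun t ht => ht.1)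
    have h3 : ∫ t in Ioc g b, (1 - q b) * (1 - δ * P t) ≤
        ∫ t in Ioc g b, (1 - q t) * (1 - δ * P t) := by
      refine setIntegral_mono_on ?_ (hint.mono_set Ioc_subset_Ioi_self) measurableSet_Ioc
        fun t ht => mul_le_mul_of_nonneg_right (by linarith [hq.mono ht.2])
          (one_sub_mul_nonneg hP h0 h1 t)
      refine Integrable.const_mul ?_ _
      refine ((integrableOn_const (C := 1 - δ) (by simp)).add
        ((hP.integrableOn_Ioc g b).const_mul δ)).congr (ae_of_all _ fun t => ?_)
      simp only [Pi.add_apply]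
      ring
    rw [integral_const_mul, ← netGain_sub (ρ := ρ) hP hgb.le] at h3
    nlinarith

/-- Beyond `b` the integral in the loss formula vanishes, and up to `b` it is at most the drop of
the net gain. If `b` is the index of the action, its net gain there is zero in the limit, and so is
the loss. -/
theorem selectionLoss_le (hP : IsRetirementCurve P) (hq : IsRetirementCurve q)
    (h0 : 0 ≤ δ) (h1 : δ ≤ 1) (h : δ < 1 ∨ ρ < 0) {m b : ℝ} (hmb : m ≤ b)
    (hqb : ∀ t, b < t → q t = 1) :
    selectionLoss ρ δ P q m ≤ max (-netGain ρ δ P b) 0 := by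
  obtain ⟨g, hmg, hg, hg', hD, hint⟩ := exists_selectionLoss_eq hP hq h0 h1 h m
  have hzero : ∀ a, b ≤ a → ∫ t in Ioi a, (1 - q t) * (1 - δ * P t) = 0 := fun a ha => by
    rw [setIntegral_congr_fun (g := fun _ => 0) measurableSet_Ioi fun t ht => by
      simp [hqb t (ha.trans_lt ht)]]
    simp
  rw [hD]
  rcases le_or_gt b g with hbg | hgb
  · rw [hzero g hbg, add_zero]
    rcases hg' with rfl | hg0
    · rw [le_antisymm hmb hbg]
      exact le_max_left _ _
    · rw [hg0, neg_zero]
      exact le_max_right _ _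
  · refine le_max_of_le_left ?_
    rw [← Ioc_union_Ioi_eq_Ioi hgb.le, setIntegral_union (Ioc_disjoint_Ioi le_rfl)
      measurableSet_Ioi (hint.mono_set Ioc_subset_Ioi_self) (hint.mono_set (Ioi_subset_Ioi hgb.le)),
      hzero b le_rfl]
    have h2 : ∫ t in Ioc g b, (1 - q t) * (1 - δ * P t) ≤ ∫ t in Ioc g b, (1 - δ * P t) := by
      refine setIntegral_mono_on (hint.mono_set Ioc_subset_Ioi_self) ?_ measurableSet_Ioc
        fun t ht => mul_le_of_le_one_left (one_sub_mul_nonneg hP h0 h1 t)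
          (by linarith [hq.nonneg t])
      refine ((integrableOn_const (C := 1 - δ) (by simp)).add
        ((hP.integrableOn_Ioc g b).const_mul δ)).congr (ae_of_all _ fun t => ?_)
      simp only [Pi.add_apply]
      ring
    rw [← netGain_sub (ρ := ρ) hP hgb.le] at h2
    linarith

end Step

end RetirementCurve

/-! ### Payoffs and finite-horizon excess: measurability and integrability -/

namespace BranchingBandit

variable {X : Type*} [MeasurableSpace X] (B : BranchingBandit X)

instance : IsMarkovKernel B.outcome := B.markov

/-- Expected immediate payoff of an action. -/
noncomputable def meanPayoff (x : X) : ℝ := ∫ o, o.1 ∂(B.outcome x)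

/-- Net gain over the outside option `m` from selecting an action in state `x`, when the excess of
the continuation value over `m` is the function `f` of the list of follow-up actions. -/
noncomputable def gain (m : ℝ) (x : X) (f : List X → ℝ≥0∞) : ℝ :=
  B.meanPayoff x + B.cont x * (m + (∫⁻ o, f o.2 ∂(B.outcome x)).toReal) - m

/-- Excess of the value over the outside option `m`, when at most `n` actions can be selected. -/
noncomputable def excess (m : ℝ) : ℕ → List X → ℝ≥0∞
  | 0, _ => 0
  | n + 1, s => ⨆ (i : ℕ) (h : i < s.length),
      ENNReal.ofReal (B.gain m s[i] fun t => excess m n (s.eraseIdx i ++ t))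

/-- Expected total absolute payoff of a list of actions and `n` generations. -/
noncomputable def absSum (n : ℕ) (s : List X) : ℝ≥0∞ := (s.map (B.expAbsPayoff n)).sum

theorem absSum_append (n : ℕ) (s t : List X) : B.absSum n (s ++ t) = B.absSum n s + B.absSum n t := by
  simp [absSum]

theorem absSum_mono_of_le {n k : ℕ} (h : B.expAbsPayoff n ≤ B.expAbsPayoff k) (s : List X) :
    B.absSum n s ≤ B.absSum k s :=
  List.sum_le_sum fun x _ => h x

theorem expAbsPayoff_le_succ (n : ℕ) : B.expAbsPayoff n ≤ B.expAbsPayoff (n + 1) := by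
  induction n with
  | zero => exact fun x => zero_le
  | succ n ih =>
    intro x
    exact lintegral_mono fun o => add_le_add le_rfl (B.absSum_mono_of_le ih o.2)

theorem absSum_le_succ (n : ℕ) (s : List X) : B.absSum n s ≤ B.absSum (n + 1) s :=
  B.absSum_mono_of_le (B.expAbsPayoff_le_succ n) s

theorem absSum_lt_top (hA : ∀ n x, B.expAbsPayoff n x < ∞) (n : ℕ) (s : List X) :
    B.absSum n s < ∞ := by
  induction s with
  | nil => simp [absSum]
  | cons x s ih =>
    have : B.absSum n (x :: s) = B.expAbsPayoff n x + B.absSum n s := by simp [absSum]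
    rw [this]
    exact ENNReal.add_lt_top.2 ⟨hA n x, ih⟩

theorem absSum_eraseIdx (n : ℕ) (s : List X) (i : ℕ) (hi : i < s.length) :
    B.absSum n s = B.expAbsPayoff n s[i] + B.absSum n (s.eraseIdx i) := by
  have := ((List.getElem_cons_eraseIdx_perm hi).map (B.expAbsPayoff n)).sum_eq
  simpa [absSum] using this.symm

theorem expAbsPayoff_succ (n : ℕ) (x : X) : B.expAbsPayoff (n + 1) x =
    (∫⁻ o, ‖o.1‖ₑ ∂(B.outcome x)) + ∫⁻ o, B.absSum n o.2 ∂(B.outcome x) := by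
  rw [← lintegral_add_left (by fun_prop)]
  rfl

theorem integrable_fst (hA : ∀ n x, B.expAbsPayoff n x < ∞) (x : X) :
    Integrable (fun o : ℝ × List X => o.1) (B.outcome x) := by
  refine ⟨measurable_fst.aestronglyMeasurable, lt_of_le_of_lt ?_ (hA 1 x)⟩
  rw [expAbsPayoff_succ]
  exact le_self_add

/-- The bound on the absolute payoff that is left after the `i`-th action has been selected. -/
theorem lintegral_absSum_le (n : ℕ) (s : List X) (i : ℕ) (hi : i < s.length) :
    ∫⁻ o, (‖o.1‖ₑ + B.absSum n (s.eraseIdx i ++ o.2)) ∂(B.outcome s[i]) ≤ B.absSum (n + 1) s := by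
  rw [lintegral_add_left (by fun_prop)]
  simp only [absSum_append]
  rw [lintegral_add_left measurable_const, lintegral_const, measure_univ, mul_one,
    B.absSum_eraseIdx (n + 1) s i hi, expAbsPayoff_succ]
  have := B.absSum_le_succ n (s.eraseIdx i)
  calc _ = ((∫⁻ o, ‖o.1‖ₑ ∂(B.outcome s[i])) + ∫⁻ o, B.absSum n o.2 ∂(B.outcome s[i])) +
        B.absSum n (s.eraseIdx i) := by ring
    _ ≤ _ := by gcongr

/-- For a fixed position the payoff is a kernel integral of a measurable function. The position
chosen by the rule takes countably many values, so the pieces can be glued. -/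
theorem measurable_payoff (m : ℝ) (π : DecisionRule X) (n : ℕ) :
    Measurable fun p : List (ℝ × List X) × List X => B.payoff m π n p.1 p.2 := by
  induction n with
  | zero => exact measurable_const
  | succ n ih =>
    have key : ∀ i : ℕ, Measurable fun p : List X × List (ℝ × List X) =>
        if h : i < p.1.length then
          ∫ o, (o.1 + B.cont p.1[i] * B.payoff m π n ((o.1, p.1) :: p.2) (p.1.eraseIdx i ++ o.2))
            ∂(B.outcome p.1[i]) else m := by
      intro i
      refine Measurable.dite_list_getElem (F := fun (x : X) (p : List X × List (ℝ × List X)) =>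
        ∫ o, (o.1 + B.cont x * B.payoff m π n ((o.1, p.1) :: p.2) (p.1.eraseIdx i ++ o.2))
          ∂(B.outcome x)) (G := fun _ => m) ?_ measurable_const i
      have hm : Measurable fun q : (X × List X × List (ℝ × List X)) × (ℝ × List X) =>
          q.2.1 + B.cont q.1.1 *
            B.payoff m π n ((q.2.1, q.1.2.1) :: q.1.2.2) (q.1.2.1.eraseIdx i ++ q.2.2) := by
        have h1 : Measurable fun q : (X × List X × List (ℝ × List X)) × (ℝ × List X) =>
            (q.2.1, q.1.2.1) :: q.1.2.2 :=
          measurable_list_cons.comp (f := fun q : (X × List X × List (ℝ × List X)) ×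
            (ℝ × List X) => ((q.2.1, q.1.2.1), q.1.2.2)) (by fun_prop)
        have h2 : Measurable fun q : (X × List X × List (ℝ × List X)) × (ℝ × List X) =>
            q.1.2.1.eraseIdx i ++ q.2.2 :=
          measurable_list_append.comp (((measurable_list_eraseIdx i).comp
            (f := fun q : (X × List X × List (ℝ × List X)) × (ℝ × List X) => q.1.2.1)
            (by fun_prop)).prodMk (by fun_prop))
        have h3 := ih.comp (h1.prodMk h2)
        have h4 := B.cont_measurable
        simp only [Function.comp_def] at h3
        fun_prop
      exact (StronglyMeasurable.integral_kernel_prod_right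
        (κ := Kernel.prodMkRight (List X × List (ℝ × List X)) B.outcome)
        (f := fun a b => b.1 + B.cont a.1 *
            B.payoff m π n ((b.1, a.2.1) :: a.2.2) (a.2.1.eraseIdx i ++ b.2))
        hm.stronglyMeasurable).measurable
    have hjoint : Measurable fun q : ℕ × (List X × List (ℝ × List X)) =>
        if h : q.1 < q.2.1.length then ∫ o, (o.1 + B.cont q.2.1[q.1] *
            B.payoff m π n ((o.1, q.2.1) :: q.2.2) (q.2.1.eraseIdx q.1 ++ o.2))
            ∂(B.outcome q.2.1[q.1]) else m :=
      measurable_from_prod_countable_right key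
    exact hjoint.comp (π.measurable_pick.prodMk (measurable_snd.prodMk measurable_fst))

theorem cont_enorm_le (x : X) : ‖B.cont x‖ₑ ≤ 1 := by
  rw [Real.enorm_of_nonneg (B.cont_nonneg x)]
  exact ENNReal.ofReal_le_one.2 (B.cont_le_one x)

theorem lintegral_add_absSum_le (m : ℝ) (n : ℕ) (s : List X) (i : ℕ) (hi : i < s.length) :
    ∫⁻ o, (‖o.1‖ₑ + (‖m‖ₑ + B.absSum n (s.eraseIdx i ++ o.2))) ∂(B.outcome s[i]) ≤
      ‖m‖ₑ + B.absSum (n + 1) s := by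
  have h : ∀ o : ℝ × List X, ‖o.1‖ₑ + (‖m‖ₑ + B.absSum n (s.eraseIdx i ++ o.2)) =
      ‖m‖ₑ + (‖o.1‖ₑ + B.absSum n (s.eraseIdx i ++ o.2)) := fun o => by ring
  simp only [h]
  rw [lintegral_add_left measurable_const, lintegral_const, measure_univ, mul_one]
  gcongr
  exact B.lintegral_absSum_le n s i hi

/-- Within `n` selections only `n` generations can be reached, and continuation factors do not
exceed one. -/
theorem enorm_payoff_le (m : ℝ) (π : DecisionRule X) (n : ℕ) (h : List (ℝ × List X)) (s : List X) :
    ‖B.payoff m π n h s‖ₑ ≤ ‖m‖ₑ + B.absSum n s := by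
  induction n generalizing h s with
  | zero => exact le_self_add
  | succ n ih =>
    simp only [payoff]
    split_ifs with hi
    · refine (enorm_integral_le_lintegral_enorm _).trans
        (le_trans (lintegral_mono fun o => ?_) (B.lintegral_add_absSum_le m n s _ hi))
      refine (enorm_add_le _ _).trans (add_le_add le_rfl ?_)
      rw [enorm_mul]
      exact (mul_le_mul' (B.cont_enorm_le _) (ih _ _)).trans (one_mul _).le
    · exact le_self_add

theorem integrable_payoff (hA : ∀ n x, B.expAbsPayoff n x < ∞) (m : ℝ) (π : DecisionRule X) (n : ℕ)
    (h : List (ℝ × List X)) (s : List X) (i : ℕ) (hi : i < s.length) :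
    Integrable (fun o => o.1 + B.cont s[i] *
      B.payoff m π n ((o.1, s) :: h) (s.eraseIdx i ++ o.2)) (B.outcome s[i]) := by
  refine ⟨?_, ?_⟩
  · refine (Measurable.add (by fun_prop) (Measurable.mul measurable_const
      ((B.measurable_payoff m π n).comp (Measurable.prodMk ?_ ?_)))).aestronglyMeasurable
    · exact measurable_list_cons.comp (f := fun o : ℝ × List X => ((o.1, s), h)) (by fun_prop)
    · exact measurable_list_append.comp
        (f := fun o : ℝ × List X => (s.eraseIdx i, o.2)) (by fun_prop)
  · refine lt_of_le_of_lt (le_trans (lintegral_mono fun o => ?_)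
      (B.lintegral_add_absSum_le m n s i hi))
      (ENNReal.add_lt_top.2 ⟨enorm_lt_top, B.absSum_lt_top hA _ _⟩)
    refine (enorm_add_le _ _).trans (add_le_add le_rfl ?_)
    rw [enorm_mul]
    exact (mul_le_mul' (B.cont_enorm_le _) (B.enorm_payoff_le _ _ _ _ _)).trans (one_mul _).le

theorem measurable_meanPayoff : Measurable B.meanPayoff :=
  (StronglyMeasurable.integral_kernel (κ := B.outcome)
    (f := fun o : ℝ × List X => o.1) measurable_fst.stronglyMeasurable).measurable

theorem measurable_gain {γ : Type*} [MeasurableSpace γ] (m : ℝ) {F : γ → List X → ℝ≥0∞}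
    (hF : Measurable (Function.uncurry F)) :
    Measurable fun p : X × γ => B.gain m p.1 (F p.2) := by
  have h : Measurable fun p : X × γ => ∫⁻ o, F p.2 o.2 ∂(B.outcome p.1) :=
    Measurable.lintegral_kernel_prod_right (κ := Kernel.prodMkRight γ B.outcome)
      (f := fun a b => F a.2 b.2) (hF.comp
        (f := fun q : (X × γ) × (ℝ × List X) => (q.1.2, q.2.2)) (by fun_prop))
  have h1 := B.measurable_meanPayoff
  have h2 := B.cont_measurable
  unfold gain
  fun_prop

theorem measurable_excess_append (m : ℝ) (n i : ℕ) (h : Measurable (B.excess m n)) :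
    Measurable (Function.uncurry fun s t : List X => B.excess m n (s.eraseIdx i ++ t)) :=
  h.comp (measurable_list_append.comp
    (((measurable_list_eraseIdx i).comp measurable_fst).prodMk measurable_snd))

theorem measurable_gain_excess (m : ℝ) (n i : ℕ) (h : Measurable (B.excess m n)) (c : ℝ) :
    Measurable fun s : List X => if h : i < s.length then
      B.gain m s[i] (fun t => B.excess m n (s.eraseIdx i ++ t)) else c := by
  have h1 := B.measurable_gain m (γ := List X × Unit)
    (F := fun p t => B.excess m n (p.1.eraseIdx i ++ t))
    ((B.measurable_excess_append m n i h).comp (f := fun q : (List X × Unit) × List X =>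
      (q.1.1, q.2)) (by fun_prop))
  have h2 := Measurable.dite_list_getElem (F := fun (x : X) (p : List X × Unit) =>
    B.gain m x fun t => B.excess m n (p.1.eraseIdx i ++ t)) h1 (measurable_const (a := c)) i
  exact h2.comp (measurable_id.prodMk (measurable_const (a := ())))

theorem measurable_excess (m : ℝ) (n : ℕ) : Measurable (B.excess m n) := by
  induction n with
  | zero => exact measurable_const
  | succ n ih =>
    refine Measurable.iSup fun i => ?_
    have h : ∀ s : List X, (⨆ h : i < s.length,
        ENNReal.ofReal (B.gain m s[i] fun t => B.excess m n (s.eraseIdx i ++ t))) =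
        ENNReal.ofReal (if h : i < s.length then
          B.gain m s[i] (fun t => B.excess m n (s.eraseIdx i ++ t)) else 0) := fun s => by
      split_ifs with hi <;> simp [hi]
    simp only [h]
    exact (B.measurable_gain_excess m n i ih 0).ennreal_ofReal

theorem gain_mono {m : ℝ} {x : X} {f g : List X → ℝ≥0∞} (hfg : ∀ t, f t ≤ g t)
    (hg : ∫⁻ o, g o.2 ∂(B.outcome x) ≠ ∞) : B.gain m x f ≤ B.gain m x g := by
  have h := ENNReal.toReal_mono hg (lintegral_mono (μ := B.outcome x) fun o => hfg o.2)
  have := mul_le_mul_of_nonneg_left h (B.cont_nonneg x)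
  unfold gain
  linarith

end BranchingBandit

/-! ### Dynamic programming with finitely many selections -/

namespace BranchingBandit

variable {X : Type*} [MeasurableSpace X] (B : BranchingBandit X)

/-- Net gain from selecting position `i` of `s` if at most `n` more actions can be selected
afterwards; it is zero for the outside option. -/
noncomputable def gainAt (m : ℝ) (n : ℕ) (s : List X) (i : ℕ) : ℝ :=
  if h : i < s.length then B.gain m s[i] (fun t => B.excess m n (s.eraseIdx i ++ t)) else 0

theorem measurable_gainAt (m : ℝ) (n i : ℕ) : Measurable fun s => B.gainAt m n s i :=
  B.measurable_gain_excess m n i (B.measurable_excess m n) 0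

theorem gainAt_of_lt {m : ℝ} {n : ℕ} {s : List X} {i : ℕ} (h : i < s.length) :
    B.gainAt m n s i = B.gain m s[i] (fun t => B.excess m n (s.eraseIdx i ++ t)) := dif_pos h

theorem gainAt_of_le {m : ℝ} {n : ℕ} {s : List X} {i : ℕ} (h : s.length ≤ i) :
    B.gainAt m n s i = 0 := dif_neg (not_lt.2 h)

/-- Positions beyond the list contribute zero, so stopping is among the indices of the supremum. -/
theorem excess_succ (m : ℝ) (n : ℕ) (s : List X) :
    B.excess m (n + 1) s = ⨆ i, ENNReal.ofReal (B.gainAt m n s i) := by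
  rw [excess]
  congr 1
  ext i
  unfold gainAt
  split_ifs with hi <;> simp [hi]

theorem ofReal_gainAt_le (m : ℝ) (n : ℕ) (s : List X) (i : ℕ) :
    ENNReal.ofReal (B.gainAt m n s i) ≤ B.excess m (n + 1) s := by
  rw [excess_succ]
  exact le_iSup (fun i => ENNReal.ofReal (B.gainAt m n s i)) i

theorem excess_le (hA : ∀ n x, B.expAbsPayoff n x < ∞) (m : ℝ) (n : ℕ) (s : List X) :
    B.excess m n s ≤ ‖m‖ₑ + B.absSum n s := by
  induction n generalizing s with
  | zero => exact zero_le
  | succ n ih =>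
    refine iSup₂_le fun i hi => ?_
    have hZ : ‖m‖ₑ + B.absSum (n + 1) s ≠ ∞ :=
      (ENNReal.add_lt_top.2 ⟨enorm_lt_top, B.absSum_lt_top hA _ _⟩).ne
    refine ENNReal.ofReal_le_of_le_toReal ?_
    have h1 := B.lintegral_add_absSum_le m n s i hi
    rw [lintegral_add_left (by fun_prop)] at h1
    set R := ∫⁻ o, ‖o.1‖ₑ ∂(B.outcome s[i])
    set J := ∫⁻ o, (‖m‖ₑ + B.absSum n (s.eraseIdx i ++ o.2)) ∂(B.outcome s[i])
    have hRJ : R + J ≠ ∞ := (h1.trans_lt hZ.lt_top).ne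
    obtain ⟨hR, hJ⟩ := ENNReal.add_ne_top.1 hRJ
    have h2 : R.toReal + J.toReal ≤ (‖m‖ₑ + B.absSum (n + 1) s).toReal := by
      rw [← ENNReal.toReal_add hR hJ]
      exact ENNReal.toReal_mono hZ h1
    have h3 : (∫⁻ o, B.excess m n (s.eraseIdx i ++ o.2) ∂(B.outcome s[i])).toReal ≤ J.toReal :=
      ENNReal.toReal_mono hJ (lintegral_mono fun o => ih _)
    have h4 : |m| ≤ J.toReal := by
      have : ‖m‖ₑ ≤ J := by
        calc ‖m‖ₑ = ∫⁻ _, ‖m‖ₑ ∂(B.outcome s[i]) := by simp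
          _ ≤ J := lintegral_mono fun o => le_self_add
      have := ENNReal.toReal_mono hJ this
      simpa using this
    have h5 : B.meanPayoff s[i] ≤ R.toReal := by
      refine (le_abs_self _).trans ?_
      have := ENNReal.toReal_mono hR (enorm_integral_le_lintegral_enorm
        (μ := B.outcome s[i]) fun o : ℝ × List X => o.1)
      simpa [meanPayoff] using this
    have hc0 := B.cont_nonneg s[i]
    have hc1 := B.cont_le_one s[i]
    have h6 := mul_le_mul_of_nonneg_left h3 hc0
    have h7 := neg_abs_le m
    unfold gain
    nlinarith

theorem excess_lt_top (hA : ∀ n x, B.expAbsPayoff n x < ∞) (m : ℝ) (n : ℕ) (s : List X) :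
    B.excess m n s < ∞ :=
  (B.excess_le hA m n s).trans_lt (ENNReal.add_lt_top.2 ⟨enorm_lt_top, B.absSum_lt_top hA _ _⟩)

theorem measurable_excess_outcome (m : ℝ) (n : ℕ) (s : List X) :
    Measurable fun o : ℝ × List X => B.excess m n (s ++ o.2) :=
  (B.measurable_excess m n).comp (measurable_list_append.comp
    (f := fun o : ℝ × List X => (s, o.2)) (by fun_prop))

theorem lintegral_excess_lt_top (hA : ∀ n x, B.expAbsPayoff n x < ∞) (m : ℝ) (n : ℕ) (x : X)
    (s : List X) : ∫⁻ o, B.excess m n (s ++ o.2) ∂(B.outcome x) < ∞ := by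
  have h := B.lintegral_add_absSum_le m n (x :: s) 0 (by simp)
  refine lt_of_le_of_lt ?_ (h.trans_lt (ENNReal.add_lt_top.2
    ⟨enorm_lt_top, B.absSum_lt_top hA _ _⟩))
  exact lintegral_mono fun o => (B.excess_le hA m n _).trans le_add_self

theorem excess_le_succ (hA : ∀ n x, B.expAbsPayoff n x < ∞) (m : ℝ) (n : ℕ) (s : List X) :
    B.excess m n s ≤ B.excess m (n + 1) s := by
  induction n generalizing s with
  | zero => exact zero_le
  | succ n ih =>
    exact iSup₂_mono fun i hi => ENNReal.ofReal_le_ofReal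
      (B.gain_mono (fun t => ih _) (B.lintegral_excess_lt_top hA m (n + 1) _ _).ne)

theorem excess_monotone (hA : ∀ n x, B.expAbsPayoff n x < ∞) (m : ℝ) (s : List X) :
    Monotone fun n => B.excess m n s :=
  monotone_nat_of_le_succ fun n => B.excess_le_succ hA m n s

theorem gainAt_monotone (hA : ∀ n x, B.expAbsPayoff n x < ∞) (m : ℝ) (s : List X) (i : ℕ) :
    Monotone fun n => B.gainAt m n s i := by
  refine monotone_nat_of_le_succ fun n => ?_
  unfold gainAt
  split_ifs with hi
  · exact B.gain_mono (fun t => B.excess_le_succ hA m n _)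
      (B.lintegral_excess_lt_top hA m (n + 1) _ _).ne
  · exact le_rfl

theorem gainAt_le_excess (hA : ∀ n x, B.expAbsPayoff n x < ∞) (m : ℝ) (n : ℕ) (s : List X) (i : ℕ) :
    B.gainAt m n s i ≤ (B.excess m (n + 1) s).toReal :=
  (ENNReal.ofReal_le_iff_le_toReal (B.excess_lt_top hA m (n + 1) s).ne).1
    (B.ofReal_gainAt_le m n s i)

theorem integrable_excess (hA : ∀ n x, B.expAbsPayoff n x < ∞) (m : ℝ) (n : ℕ) (x : X)
    (s : List X) : Integrable (fun o => (B.excess m n (s ++ o.2)).toReal) (B.outcome x) :=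
  integrable_toReal_of_lintegral_ne_top (B.measurable_excess_outcome m n s).aemeasurable
    (B.lintegral_excess_lt_top hA m n x s).ne

theorem integral_add_excess (hA : ∀ n x, B.expAbsPayoff n x < ∞) (m : ℝ) (n : ℕ) (x : X)
    (s : List X) :
    ∫ o, (o.1 + B.cont x * (m + (B.excess m n (s ++ o.2)).toReal)) ∂(B.outcome x) =
      m + B.gain m x fun t => B.excess m n (s ++ t) := by
  have h1 := B.integrable_excess hA m n x s
  have h2 : Integrable (fun o => B.cont x * (m + (B.excess m n (s ++ o.2)).toReal))
      (B.outcome x) := ((integrable_const m).add h1).const_mul _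
  rw [integral_add (B.integrable_fst hA x) h2,
    integral_const_mul, integral_add (integrable_const m) h1,
    integral_toReal (B.measurable_excess_outcome m n s).aemeasurable
      (ae_of_all _ fun o => B.excess_lt_top hA m n _)]
  simp [gain, meanPayoff]

theorem integral_payoff_le (hA : ∀ n x, B.expAbsPayoff n x < ∞) (m : ℝ) (π : DecisionRule X) (n : ℕ)
    (ih : ∀ h s, B.payoff m π n h s ≤ m + (B.excess m n s).toReal)
    (h : List (ℝ × List X)) (s : List X) (i : ℕ) (hi : i < s.length) :
    ∫ o, (o.1 + B.cont s[i] * B.payoff m π n ((o.1, s) :: h) (s.eraseIdx i ++ o.2))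
      ∂(B.outcome s[i]) ≤ m + B.gainAt m n s i := by
  rw [gainAt_of_lt _ hi, ← B.integral_add_excess hA]
  refine integral_mono (B.integrable_payoff hA m π n h s i hi) ?_ fun o => ?_
  · exact (B.integrable_fst hA _).add
      (((integrable_const m).add (B.integrable_excess hA m n _ _)).const_mul _)
  · have := mul_le_mul_of_nonneg_left (ih ((o.1, s) :: h) (s.eraseIdx i ++ o.2))
      (B.cont_nonneg s[i])
    simp only
    linarith

theorem payoff_le (hA : ∀ n x, B.expAbsPayoff n x < ∞) (m : ℝ) (π : DecisionRule X) (n : ℕ)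
    (h : List (ℝ × List X)) (s : List X) :
    B.payoff m π n h s ≤ m + (B.excess m n s).toReal := by
  induction n generalizing h s with
  | zero => simp [payoff]
  | succ n ih =>
    simp only [payoff]
    split_ifs with hi
    · have h1 := B.integral_payoff_le hA m π n ih h s _ hi
      have h2 := B.gainAt_le_excess hA m n s (π.pick h s)
      linarith
    · exact le_add_of_nonneg_right ENNReal.toReal_nonneg

/-- The first alternative, stopping, guarantees existence. The least such `i` is therefore a total
choice function, and it is measurable because each condition on `i` is. -/
theorem exists_best (m : ℝ) (n : ℕ) (s : List X) :
    ∃ i, s.length ≤ i ∨ 0 < B.gainAt m n s i ∧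
      ENNReal.ofReal (B.gainAt m n s i) = B.excess m (n + 1) s :=
  ⟨s.length, Or.inl le_rfl⟩

open Classical in
/-- An optimal choice if at most `n + 1` actions can be selected. -/
noncomputable def bestIndex (m : ℝ) (n : ℕ) (s : List X) : ℕ := Nat.find (B.exists_best m n s)

theorem measurable_bestIndex (m : ℝ) (n : ℕ) : Measurable (B.bestIndex m n) := by
  classical
  refine measurable_find _ fun i => ?_
  have h1 : MeasurableSet {s : List X | s.length ≤ i} :=
    measurableSet_le measurable_list_length measurable_const
  have h2 : MeasurableSet {s : List X | 0 < B.gainAt m n s i} :=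
    measurableSet_lt measurable_const (B.measurable_gainAt m n i)
  have h3 : MeasurableSet {s : List X |
      ENNReal.ofReal (B.gainAt m n s i) = B.excess m (n + 1) s} :=
    measurableSet_eq_fun (B.measurable_gainAt m n i).ennreal_ofReal (B.measurable_excess m (n + 1))
  exact h1.union (h2.inter h3)

theorem gainAt_bestIndex (m : ℝ) (n : ℕ) (s : List X) :
    B.gainAt m n s (B.bestIndex m n s) = (B.excess m (n + 1) s).toReal := by
  classical
  rcases Nat.find_spec (B.exists_best m n s) with h | ⟨hpos, heq⟩
  · have h' : s.length ≤ B.bestIndex m n s := h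
    rw [gainAt_of_le _ h']
    suffices B.excess m (n + 1) s = 0 by simp [this]
    -- If the excess were positive, a position attaining the maximum would satisfy the second
    -- alternative and would have been found before the end of the list.
    by_contra hne
    have hlen : s.length ≠ 0 := fun h0 => hne (by simp [excess, h0])
    have : Nonempty (Fin s.length) := ⟨⟨0, Nat.pos_of_ne_zero hlen⟩⟩
    obtain ⟨j, hj⟩ := Finite.exists_max fun i : Fin s.length => B.gainAt m n s i
    have hje : ENNReal.ofReal (B.gainAt m n s j) = B.excess m (n + 1) s := by
      refine le_antisymm (B.ofReal_gainAt_le m n s j) (iSup₂_le fun i hi => ?_)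
      rw [← gainAt_of_lt]
      exact ENNReal.ofReal_le_ofReal (hj ⟨i, hi⟩)
    have hpos : 0 < B.gainAt m n s j := by
      rw [← ENNReal.ofReal_pos, hje]
      exact pos_iff_ne_zero.2 hne
    exact absurd (h.trans (Nat.find_min' (B.exists_best m n s) (Or.inr ⟨hpos, hje⟩)))
      (not_le.2 j.2)
  · have heq' : ENNReal.ofReal (B.gainAt m n s (B.bestIndex m n s)) = B.excess m (n + 1) s := heq
    have hpos' : 0 < B.gainAt m n s (B.bestIndex m n s) := hpos
    rw [← heq', ENNReal.toReal_ofReal hpos'.le]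

/-- The rule that follows a plan for each stage. -/
def stageRule (f : ℕ → List X → ℕ) (hf : ∀ n, Measurable (f n)) : DecisionRule X where
  pick h s := f h.length s
  measurable_pick := by
    have : Measurable fun q : ℕ × List X => f q.1 q.2 := measurable_from_prod_countable_right hf
    exact this.comp ((measurable_list_length.comp measurable_fst).prodMk measurable_snd)

theorem payoff_succ (m : ℝ) (π : DecisionRule X) (n : ℕ) (h : List (ℝ × List X)) (s : List X)
    (hA : ∀ n x, B.expAbsPayoff n x < ∞)
    (hn : ∀ r t, B.payoff m π n ((r, s) :: h) t = m + (B.excess m n t).toReal) :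
    B.payoff m π (n + 1) h s = m + B.gainAt m n s (π.pick h s) := by
  simp only [payoff, hn]
  split_ifs with hi
  · rw [B.integral_add_excess hA, gainAt_of_lt]
  · rw [gainAt_of_le _ (not_lt.1 hi), add_zero]

/-- The length of the history serves as the clock, which leaves `N - k` selections at stage `k`.
Only the stages from `K` on need to be optimal: `K = 0` yields the value, `K = 1` the value with a
prescribed first choice. -/
theorem payoff_stageRule (hA : ∀ n x, B.expAbsPayoff n x < ∞) (m : ℝ) (N K : ℕ)
    (f : ℕ → List X → ℕ) (hf : ∀ n, Measurable (f n))
    (hbest : ∀ k, K ≤ k → f k = B.bestIndex m (N - k - 1)) (n : ℕ) (h : List (ℝ × List X))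
    (s : List X) (hK : K ≤ h.length) (hN : h.length + n = N) :
    B.payoff m (stageRule f hf) n h s = m + (B.excess m n s).toReal := by
  induction n generalizing h s with
  | zero => simp [payoff, excess]
  | succ n ih =>
    rw [B.payoff_succ m _ n h s hA fun r t => ih _ _ (by simp; omega) (by simp; omega)]
    have : (stageRule f hf).pick h s = B.bestIndex m n s := by
      simp only [stageRule, hbest _ hK]
      congr 1
      omega
    rw [this, gainAt_bestIndex]

theorem value_eq (hA : ∀ n x, B.expAbsPayoff n x < ∞) (m : ℝ) (s : List X) :
    B.value m s = ⨆ n, ((m + (B.excess m n s).toReal : ℝ) : EReal) := by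
  apply le_antisymm
  · exact iSup₂_le fun π n => le_iSup_of_le n (EReal.coe_le_coe (B.payoff_le hA m π n [] s))
  · refine iSup_le fun n => ?_
    have h := B.payoff_stageRule hA m n 0 (fun k => B.bestIndex m (n - k - 1))
      (fun k => B.measurable_bestIndex m _) (fun k _ => rfl) n [] s le_rfl (by simp)
    rw [← h]
    exact le_iSup₂ (f := fun π n => ((B.payoff m π n [] s : ℝ) : EReal)) _ n

theorem valueVia_eq (hA : ∀ n x, B.expAbsPayoff n x < ∞) (m : ℝ) (s : List X) (i : ℕ) :
    B.valueVia m s i = ⨆ n, ((m + B.gainAt m n s i : ℝ) : EReal) := by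
  apply le_antisymm
  · refine iSup₂_le fun π hπ => iSup_le fun n => le_iSup_of_le n (EReal.coe_le_coe ?_)
    simp only [payoff]
    split_ifs with hi
    · refine (B.integral_payoff_le hA m π n (B.payoff_le hA m π n) [] s _ hi).trans_eq ?_
      rw [hπ]
    · rw [hπ] at hi
      rw [gainAt_of_le _ (not_lt.1 hi), add_zero]
  · refine iSup_le fun n => ?_
    -- The first choice is forced; all later ones are optimal for the selections that are left.
    set f : ℕ → List X → ℕ := fun k => if k = 0 then fun _ => i else B.bestIndex m (n + 1 - k - 1)
    have hf : ∀ k, Measurable (f k) := fun k => by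
      simp only [f]
      split_ifs
      exacts [measurable_const, B.measurable_bestIndex m _]
    have hbest : ∀ k, 1 ≤ k → f k = B.bestIndex m (n + 1 - k - 1) := fun k hk =>
      if_neg (by omega)
    have h := B.payoff_succ m (stageRule f hf) n [] s hA fun r t =>
      B.payoff_stageRule hA m (n + 1) 1 f hf hbest n _ t (by simp) (by simp; omega)
    have hp : (stageRule f hf).pick [] s = i := by simp [stageRule, f]
    rw [hp] at h
    rw [← h]
    exact le_iSup_of_le (stageRule f hf) (le_iSup_of_le hp
      (le_iSup (fun n => ((B.payoff m (stageRule f hf) (n + 1) [] s : ℝ) : EReal)) n))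

end BranchingBandit

/-! ### Retirement curves of actions with finitely many generations -/

section ListCurves

variable {α : Type*} {f : α → ℝ → ℝ}

theorem isRetirementCurve_list (hf : ∀ a, IsRetirementCurve (f a)) (l : List α) :
    IsRetirementCurve fun t => (l.map fun a => f a t).prod := by
  induction l with
  | nil => simpa using isRetirementCurve_one
  | cons a l ih => simpa using (hf a).mul ih

theorem ofReal_shortfall_list_le (hf : ∀ a, IsRetirementCurve (f a)) {m : ℝ} {A : α → ℝ≥0∞}
    (hA : ∀ a, ENNReal.ofReal (shortfall (f a) m) ≤ A a) (l : List α) :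
    ENNReal.ofReal (shortfall (fun t => (l.map fun a => f a t).prod) m) ≤ (l.map A).sum := by
  induction l with
  | nil => simp [shortfall]
  | cons a l ih =>
    have h := (hf a).shortfall_mul_le (isRetirementCurve_list hf l) m
    simp only [List.map_cons, List.prod_cons, List.sum_cons]
    refine (ENNReal.ofReal_le_ofReal h).trans (ENNReal.ofReal_add_le.trans ?_)
    exact add_le_add (hA a) ih

/-- The shortfall is antitone and 1-Lipschitz, so a bound at zero controls it at every outside
option. -/
theorem IsRetirementCurve.ofReal_shortfall_le {q : ℝ → ℝ} (hq : IsRetirementCurve q) (m : ℝ) :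
    ENNReal.ofReal (shortfall q m) ≤ ‖m‖ₑ + ENNReal.ofReal (shortfall q 0) := by
  have h : shortfall q m ≤ |m| + shortfall q 0 := by
    rcases le_total 0 m with hm | hm
    · linarith [hq.shortfall_antitone hm, abs_nonneg m]
    · have h1 := hq.shortfall_sub_le hm
      rw [abs_of_nonpos hm]
      nlinarith [hq.nonneg m]
  refine (ENNReal.ofReal_le_ofReal h).trans (ENNReal.ofReal_add_le.trans ?_)
  rw [← ofReal_norm, Real.norm_eq_abs]

end ListCurves

namespace BranchingBandit

variable {X : Type*} [MeasurableSpace X] (B : BranchingBandit X)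

/-- Mean over the outcomes of an action of the joint retirement curve of its follow-up actions. -/
noncomputable def avgCurve (p : X → ℝ → ℝ) (x : X) (t : ℝ) : ℝ :=
  ∫ o, (o.2.map fun y => p y t).prod ∂(B.outcome x)

/-- Retirement curve of an action of which `k` generations can be selected. -/
noncomputable def curve : ℕ → X → ℝ → ℝ
  | 0 => fun _ _ => 1
  | k + 1 => fun x => stepCurve (B.meanPayoff x) (B.cont x) (B.avgCurve (curve k) x)

section Avg

variable {p : X → ℝ → ℝ}

theorem measurable_prodCurve (hp : Measurable (Function.uncurry p)) :
    Measurable fun q : (ℝ × List X) × ℝ => (q.1.2.map fun y => p y q.2).prod :=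
  (measurable_list_map_prod hp).comp (f := fun q : (ℝ × List X) × ℝ => (q.1.2, q.2))
    (by fun_prop)

theorem measurable_avgCurve (hp : Measurable (Function.uncurry p)) :
    Measurable (Function.uncurry (B.avgCurve p)) := by
  have h := (measurable_prodCurve hp).comp
    (f := fun q : (X × ℝ) × (ℝ × List X) => (q.2, q.1.2)) (by fun_prop)
  exact (StronglyMeasurable.integral_kernel_prod_right (κ := Kernel.prodMkRight ℝ B.outcome)
    (f := fun a o => (o.2.map fun y => p y a.2).prod) h.stronglyMeasurable).measurable

theorem integrable_prodCurve (hp : Measurable (Function.uncurry p))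
    (hR : ∀ y, IsRetirementCurve (p y)) (x : X) (t : ℝ) :
    Integrable (fun o => (o.2.map fun y => p y t).prod) (B.outcome x) := by
  refine Integrable.of_bound (C := 1) ((measurable_prodCurve hp).comp
    (f := fun o : ℝ × List X => (o, t)) (by fun_prop)).aestronglyMeasurable
    (ae_of_all _ fun o => ?_)
  rw [Real.norm_of_nonneg ((isRetirementCurve_list hR o.2).nonneg t)]
  exact (isRetirementCurve_list hR o.2).le_one t

theorem avgCurve_le_one (hp : Measurable (Function.uncurry p))
    (hR : ∀ y, IsRetirementCurve (p y)) (x : X) (t : ℝ) : B.avgCurve p x t ≤ 1 := by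
  have h := integral_mono (B.integrable_prodCurve hp hR x t)
    (integrable_const (μ := B.outcome x) (1 : ℝ))
    fun o => (isRetirementCurve_list hR o.2).le_one t
  simpa [avgCurve] using h

/-- Tonelli's theorem. The curve `q` of the other actions does not depend on the outcome, so only
the product over the follow-up actions is averaged; this is the use of independence. -/
theorem lintegral_shortfall (hp : Measurable (Function.uncurry p))
    (hR : ∀ y, IsRetirementCurve (p y)) {q : ℝ → ℝ} (hq : IsRetirementCurve q) (x : X) (m : ℝ) :
    ∫⁻ o, ENNReal.ofReal (shortfall (fun t => (o.2.map fun y => p y t).prod * q t) m)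
      ∂(B.outcome x) =
      ∫⁻ t in Set.Ioi m, ENNReal.ofReal (1 - B.avgCurve p x t * q t) := by
  have hprod := fun o : ℝ × List X => (isRetirementCurve_list hR o.2).mul hq
  simp only [fun o => (hprod o).ofReal_shortfall m]
  rw [lintegral_lintegral_swap]
  · refine lintegral_congr fun t => ?_
    rw [avgCurve, ← integral_mul_const, ← ofReal_integral_eq_lintegral_ofReal]
    · rw [integral_sub (integrable_const 1) ((B.integrable_prodCurve hp hR x t).mul_const _)]
      simp
    · exact (integrable_const 1).sub ((B.integrable_prodCurve hp hR x t).mul_const _)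
    · exact ae_of_all _ fun o => (hprod o).one_sub_nonneg t
  · have h1 := measurable_prodCurve hp
    have h2 := hq.measurable
    refine Measurable.aemeasurable ?_
    unfold Function.uncurry
    fun_prop

theorem isRetirementCurve_avg (hp : Measurable (Function.uncurry p))
    (hR : ∀ y, IsRetirementCurve (p y)) (x : X)
    (hfin : ∀ m, ∫⁻ o, ENNReal.ofReal (shortfall (fun t => (o.2.map fun y => p y t).prod) m)
      ∂(B.outcome x) < ∞) :
    IsRetirementCurve (B.avgCurve p x) where
  mono a b hab := integral_mono (B.integrable_prodCurve hp hR x a) (B.integrable_prodCurve hp hR x b)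
    fun o => (isRetirementCurve_list hR o.2).mono hab
  nonneg t := integral_nonneg fun o => (isRetirementCurve_list hR o.2).nonneg t
  le_one t := B.avgCurve_le_one hp hR x t
  integrable m := by
    have h := B.lintegral_shortfall hp hR isRetirementCurve_one x m
    simp only [mul_one] at h
    have hmeas : Measurable fun t => 1 - B.avgCurve p x t :=
      measurable_const.sub ((B.measurable_avgCurve hp).comp
        (f := fun t : ℝ => (x, t)) (by fun_prop))
    refine ⟨hmeas.aestronglyMeasurable, ?_⟩
    refine lt_of_le_of_lt (le_of_eq (lintegral_congr fun t => ?_)) (h ▸ hfin m)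
    exact Real.enorm_of_nonneg (sub_nonneg.2 (B.avgCurve_le_one hp hR x t))

end Avg

/-- The retirement curves are well behaved. -/
structure CurveSpec (k : ℕ) : Prop where
  measurable : Measurable (Function.uncurry (B.curve k))
  isCurve : ∀ x, IsRetirementCurve (B.curve k x)
  shortfall_le : ∀ x, ENNReal.ofReal (shortfall (B.curve k x) 0) ≤ B.expAbsPayoff k x

namespace CurveSpec

variable {B} {k : ℕ}

theorem lintegral_shortfall_zero_le (hk : B.CurveSpec k) (x : X) :
    ∫⁻ o, ENNReal.ofReal (shortfall (fun t => (o.2.map fun y => B.curve k y t).prod) 0)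
      ∂(B.outcome x) ≤ ∫⁻ o, B.absSum k o.2 ∂(B.outcome x) :=
  lintegral_mono fun o => ofReal_shortfall_list_le hk.isCurve hk.shortfall_le o.2

theorem avg (hA : ∀ n x, B.expAbsPayoff n x < ∞) (hk : B.CurveSpec k) (x : X) :
    IsRetirementCurve (B.avgCurve (B.curve k) x) := by
  refine B.isRetirementCurve_avg hk.measurable hk.isCurve x fun m => ?_
  have h1 : ∫⁻ o, (‖m‖ₑ + B.absSum k o.2) ∂(B.outcome x) < ∞ := by
    rw [lintegral_add_left measurable_const, lintegral_const, measure_univ, mul_one]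
    have := hA (k + 1) x
    rw [expAbsPayoff_succ] at this
    exact ENNReal.add_lt_top.2 ⟨enorm_lt_top, (ENNReal.add_lt_top.1 this).2⟩
  refine lt_of_le_of_lt (lintegral_mono fun o => ?_) h1
  refine ((isRetirementCurve_list hk.isCurve o.2).ofReal_shortfall_le m).trans ?_
  exact add_le_add le_rfl (ofReal_shortfall_list_le hk.isCurve hk.shortfall_le o.2)

end CurveSpec

/-- The three properties support each other: measurability allows averaging over outcomes, and the
bound by the expected absolute payoff makes the averaged curve integrable at infinity, so that it
can enter the next step. -/
theorem curveSpec (hA : ∀ n x, B.expAbsPayoff n x < ∞) (hcost : B.CostlyActions) (k : ℕ) :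
    B.CurveSpec k := by
  induction k with
  | zero =>
    exact ⟨measurable_const, fun x => isRetirementCurve_one, fun x => by simp [curve, shortfall]⟩
  | succ k ih =>
    have havg := fun x => ih.avg hA x
    refine ⟨?_, fun x => (havg x).step (B.cont_nonneg x) (B.cont_le_one x) (hcost x), fun x => ?_⟩
    · have h1 := B.measurable_avgCurve ih.measurable
      have h2 := B.measurable_meanPayoff
      have h3 := B.cont_measurable
      have h4 : Measurable fun q : X × ℝ => shortfall (B.avgCurve (B.curve k) q.1) q.2 := by
        have h5 : Measurable fun r : (X × ℝ) × ℝ =>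
            (Set.Ioi r.1.2).indicator (fun t => 1 - B.avgCurve (B.curve k) r.1.1 t) r.2 := by
          simp only [Set.indicator_apply, Set.mem_Ioi]
          refine Measurable.ite (measurableSet_lt (by fun_prop) (by fun_prop)) ?_ measurable_const
          exact measurable_const.sub (h1.comp (f := fun r : (X × ℝ) × ℝ => (r.1.1, r.2))
            (by fun_prop))
        have h6 := (StronglyMeasurable.integral_prod_right (ν := (volume : Measure ℝ))
          (f := fun (q : X × ℝ) t =>
            (Set.Ioi q.2).indicator (fun t => 1 - B.avgCurve (B.curve k) q.1 t) t)
          h5.stronglyMeasurable).measurable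
        simp only [integral_indicator measurableSet_Ioi] at h6
        exact h6
      have h7 : Measurable fun q : X × ℝ =>
          netGain (B.meanPayoff q.1) (B.cont q.1) (B.avgCurve (B.curve k) q.1) q.2 := by
        unfold netGain
        fun_prop
      exact Measurable.ite (measurableSet_lt measurable_const h7)
        ((h3.comp measurable_fst).mul h1) measurable_const
    · have hS := ENNReal.ofReal_le_ofReal (le_of_eq (shortfall_stepCurve (havg x)
        (B.cont_nonneg x) (B.cont_le_one x) (hcost x) 0))
      refine hS.trans ?_
      have h1 : ENNReal.ofReal (shortfall (B.avgCurve (B.curve k) x) 0) ≤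
          ∫⁻ o, B.absSum k o.2 ∂(B.outcome x) := by
        have h := B.lintegral_shortfall ih.measurable ih.isCurve isRetirementCurve_one x 0
        simp only [mul_one] at h
        rw [(havg x).ofReal_shortfall, ← h]
        exact ih.lintegral_shortfall_zero_le x
      have h2 : ENNReal.ofReal (B.meanPayoff x) ≤ ∫⁻ o, ‖o.1‖ₑ ∂(B.outcome x) :=
        (Real.ofReal_le_enorm _).trans (enorm_integral_le_lintegral_enorm _)
      have h3 : max (netGain (B.meanPayoff x) (B.cont x) (B.avgCurve (B.curve k) x) 0) 0 ≤
          max (B.meanPayoff x) 0 + shortfall (B.avgCurve (B.curve k) x) 0 := by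
        have h4 := (havg x).shortfall_nonneg 0
        refine max_le ?_ (add_nonneg (le_max_right _ _) h4)
        have := le_max_left (B.meanPayoff x) 0
        have h5 := mul_le_of_le_one_left h4 (B.cont_le_one x)
        simp only [netGain]
        linarith
      rw [expAbsPayoff_succ]
      refine (ENNReal.ofReal_le_ofReal h3).trans (ENNReal.ofReal_add_le.trans (add_le_add ?_ h1))
      rw [ENNReal.ofReal_max]
      simpa using h2

/-- Joint retirement curve of a list of actions with their numbers of generations. -/
noncomputable def listCurve (l : List (X × ℕ)) (t : ℝ) : ℝ :=
  (l.map fun a => B.curve a.2 a.1 t).prod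

theorem isRetirementCurve_listCurve (hA : ∀ n x, B.expAbsPayoff n x < ∞) (hcost : B.CostlyActions)
    (l : List (X × ℕ)) : IsRetirementCurve (B.listCurve l) :=
  isRetirementCurve_list (f := fun a : X × ℕ => B.curve a.2 a.1)
    (fun a => (B.curveSpec hA hcost a.2).isCurve a.1) l

/-- The excess value of a list of actions with their numbers of generations. -/
noncomputable def indexExcess (m : ℝ) (l : List (X × ℕ)) : ℝ≥0∞ :=
  ENNReal.ofReal (shortfall (B.listCurve l) m)

/-- The net gain from an action of which `k` generations of descendants can be selected. -/
noncomputable def levelGain (k : ℕ) (x : X) (c : ℝ) : ℝ :=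
  netGain (B.meanPayoff x) (B.cont x) (B.avgCurve (B.curve k) x) c

/-- The loss from selecting an action of which `k` generations of descendants can be selected,
next to the list `l`. -/
noncomputable def levelLoss (k : ℕ) (x : X) (l : List (X × ℕ)) (m : ℝ) : ℝ :=
  selectionLoss (B.meanPayoff x) (B.cont x) (B.avgCurve (B.curve k) x) (B.listCurve l) m

theorem listCurve_append_level (l : List (X × ℕ)) (s : List X) (k : ℕ) (t : ℝ) :
    B.listCurve (l ++ s.map fun y => (y, k)) t =
      (s.map fun y => B.curve k y t).prod * B.listCurve l t := by
  simp [listCurve, Function.comp_def, mul_comm]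

theorem lintegral_indexExcess (hA : ∀ n x, B.expAbsPayoff n x < ∞) (hcost : B.CostlyActions)
    (k : ℕ) (x : X) (l : List (X × ℕ)) (m : ℝ) :
    ∫⁻ o, B.indexExcess m (l ++ o.2.map fun y => (y, k)) ∂(B.outcome x) =
      ENNReal.ofReal (shortfall (fun t => B.avgCurve (B.curve k) x t * B.listCurve l t) m) := by
  have hk := B.curveSpec hA hcost k
  have hl := B.isRetirementCurve_listCurve hA hcost l
  rw [((hk.avg hA x).mul hl).ofReal_shortfall, ← B.lintegral_shortfall hk.measurable hk.isCurve hl]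
  refine lintegral_congr fun o => ?_
  simp only [indexExcess, funext (B.listCurve_append_level l o.2 k)]

/-- One Bellman step applied to the product formula: the follow-up actions inherit one generation
less, and selecting the action misses the formula by exactly its loss. -/
theorem gain_indexExcess (hA : ∀ n x, B.expAbsPayoff n x < ∞) (hcost : B.CostlyActions)
    (k : ℕ) (x : X) (l : List (X × ℕ)) (m : ℝ) :
    B.gain m x (fun t => B.indexExcess m (l ++ t.map fun y => (y, k))) =
      shortfall (B.listCurve ((x, k + 1) :: l)) m - B.levelLoss k x l m := by
  have hk := B.curveSpec hA hcost k
  have hl := B.isRetirementCurve_listCurve hA hcost l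
  rw [gain, B.lintegral_indexExcess hA hcost,
    ENNReal.toReal_ofReal (((hk.avg hA x).mul hl).shortfall_nonneg m), levelLoss, selectionLoss]
  have : B.listCurve ((x, k + 1) :: l) = fun t => stepCurve (B.meanPayoff x) (B.cont x)
      (B.avgCurve (B.curve k) x) t * B.listCurve l t := by
    funext t
    simp [listCurve, curve]
  rw [this]
  ring

theorem listCurve_perm {l l' : List (X × ℕ)} (h : l.Perm l') : B.listCurve l = B.listCurve l' := by
  funext t
  exact (h.map _).prod_eq

end BranchingBandit

/-! ### The product formula against the finite-horizon excess -/

namespace BranchingBandit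

variable {X : Type*} [MeasurableSpace X] (B : BranchingBandit X)

theorem gain_indexExcess_eraseIdx (hA : ∀ n x, B.expAbsPayoff n x < ∞) (hcost : B.CostlyActions)
    (m : ℝ) (l : List (X × ℕ)) (i : ℕ) (hi : i < l.length) (k : ℕ) (hk : l[i].2 = k + 1) :
    B.gain m l[i].1 (fun t => B.indexExcess m (l.eraseIdx i ++ t.map fun y => (y, k))) =
      shortfall (B.listCurve l) m - B.levelLoss k l[i].1 (l.eraseIdx i) m := by
  rw [B.gain_indexExcess hA hcost, ← hk, Prod.mk.eta,
    B.listCurve_perm (List.getElem_cons_eraseIdx_perm hi)]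

theorem lintegral_indexExcess_ne_top (hA : ∀ n x, B.expAbsPayoff n x < ∞)
    (hcost : B.CostlyActions) (k : ℕ) (x : X) (l : List (X × ℕ)) (m : ℝ) :
    ∫⁻ o, B.indexExcess m (l ++ o.2.map fun y => (y, k)) ∂(B.outcome x) ≠ ∞ := by
  rw [B.lintegral_indexExcess hA hcost]
  exact ENNReal.ofReal_ne_top

theorem levelLoss_nonneg (hA : ∀ n x, B.expAbsPayoff n x < ∞) (hcost : B.CostlyActions)
    (k : ℕ) (x : X) (l : List (X × ℕ)) (m : ℝ) : 0 ≤ B.levelLoss k x l m :=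
  selectionLoss_nonneg ((B.curveSpec hA hcost k).avg hA x) (B.isRetirementCurve_listCurve hA hcost l)
    (B.cont_nonneg x) (B.cont_le_one x) (hcost x) m

theorem map_fst_append_level {Y : Type*} (l : List (Y × ℕ)) (i : ℕ) (t : List Y) (k : ℕ) :
    (l.eraseIdx i ++ t.map fun y => (y, k)).map Prod.fst = (l.map Prod.fst).eraseIdx i ++ t := by
  simp [List.eraseIdx_map, Function.comp_def]

/-- At most `n` selections reach at most `n` generations. -/
theorem excess_le_indexExcess (hA : ∀ n x, B.expAbsPayoff n x < ∞) (hcost : B.CostlyActions)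
    (m : ℝ) (n : ℕ) (l : List (X × ℕ)) (hl : ∀ a ∈ l, n ≤ a.2) :
    B.excess m n (l.map Prod.fst) ≤ B.indexExcess m l := by
  induction n generalizing l with
  | zero => exact zero_le
  | succ n ih =>
    refine iSup₂_le fun i hi' => ENNReal.ofReal_le_ofReal ?_
    have hi : i < l.length := by simpa using hi'
    obtain ⟨k, hk⟩ : ∃ k, l[i].2 = k + 1 :=
      ⟨l[i].2 - 1, by have := hl _ (List.getElem_mem hi); omega⟩
    have hnk : n ≤ k := by have := hl _ (List.getElem_mem hi); omega
    rw [List.getElem_map]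
    refine (B.gain_mono
      (g := fun t => B.indexExcess m (l.eraseIdx i ++ t.map fun y => (y, k))) (fun t => ?_)
      (B.lintegral_indexExcess_ne_top hA hcost k l[i].1 (l.eraseIdx i) m)).trans ?_
    · rw [← map_fst_append_level l i t k]
      refine ih _ fun a ha => ?_
      rcases List.mem_append.1 ha with h | h
      · exact (Nat.le_succ n).trans (hl a (List.mem_of_mem_eraseIdx h))
      · obtain ⟨y, -, rfl⟩ := List.mem_map.1 h
        exact hnk
    -- No first choice beats the product formula, because losses are nonnegative.
    · rw [B.gain_indexExcess_eraseIdx hA hcost m l i hi k hk]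
      linarith [B.levelLoss_nonneg hA hcost k l[i].1 (l.eraseIdx i) m]

/-- A continuation excess below the limit of the finite-horizon excesses is nearly achieved by a
finite horizon. -/
theorem exists_gain_le (hA : ∀ n x, B.expAbsPayoff n x < ∞) (m : ℝ) (x : X) (s : List X)
    {f : List X → ℝ≥0∞} (hf : ∀ t, f t ≤ ⨆ n, B.excess m n (s ++ t))
    (hfin : ∫⁻ o, f o.2 ∂(B.outcome x) ≠ ∞) {ε : ℝ} (hε : 0 < ε) :
    ∃ n, B.gain m x f - ε ≤ B.gain m x fun t => B.excess m n (s ++ t) := by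
  set F := ∫⁻ o, f o.2 ∂(B.outcome x) with hF
  have hsup : F ≤ ⨆ n, ∫⁻ o, B.excess m n (s ++ o.2) ∂(B.outcome x) := by
    -- Monotone convergence turns the pointwise bound by the limit into a bound by integrals with
    -- finite horizons.
    rw [← lintegral_iSup (fun n => B.measurable_excess_outcome m n s)
      fun n k hnk o => B.excess_monotone hA m _ hnk]
    exact lintegral_mono fun o => hf o.2
  have key : ∃ n, F.toReal - ε ≤ (∫⁻ o, B.excess m n (s ++ o.2) ∂(B.outcome x)).toReal := by
    by_cases h0 : F.toReal - ε ≤ 0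
    · exact ⟨0, h0.trans ENNReal.toReal_nonneg⟩
    have hlt : ENNReal.ofReal (F.toReal - ε) < F := by
      rw [ENNReal.ofReal_lt_iff_lt_toReal (not_le.1 h0).le hfin]
      linarith
    obtain ⟨n, hn⟩ := lt_iSup_iff.1 (hlt.trans_le hsup)
    exact ⟨n, (ENNReal.ofReal_le_iff_le_toReal (B.lintegral_excess_lt_top hA m n x s).ne).1 hn.le⟩
  obtain ⟨n, hn⟩ := key
  refine ⟨n, ?_⟩
  have h1 := mul_le_mul_of_nonneg_left hn (B.cont_nonneg x)
  have h2 := mul_le_of_le_one_left hε.le (B.cont_le_one x)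
  simp only [gain, ← hF]
  linarith

theorem exists_curve_threshold (hA : ∀ n x, B.expAbsPayoff n x < ∞) (hcost : B.CostlyActions)
    (m : ℝ) (a : X × ℕ) :
    ∃ g, m ≤ g ∧ (∀ t, g < t → B.curve a.2 a.1 t = 1) ∧
      (g = m ∨ ∃ k, a.2 = k + 1 ∧ B.levelGain k a.1 g = 0) := by
  obtain ⟨x, k⟩ := a
  cases k with
  | zero => exact ⟨m, le_rfl, fun t _ => rfl, Or.inl rfl⟩
  | succ k =>
    have havg := (B.curveSpec hA hcost k).avg hA x
    obtain ⟨g, hmg, hg, hg', -⟩ :=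
      exists_threshold havg (B.cont_nonneg x) (B.cont_le_one x) (hcost x) m
    exact ⟨g, hmg, fun t ht => stepCurve_eq_one havg (B.cont_nonneg x) (B.cont_le_one x) hg ht.le,
      hg'.imp id fun h => ⟨k, rfl, h⟩⟩

theorem levelLoss_le (hA : ∀ n x, B.expAbsPayoff n x < ∞) (hcost : B.CostlyActions)
    (k : ℕ) (x : X) (l : List (X × ℕ)) {m g : ℝ} (hmg : m ≤ g)
    (hl : ∀ a ∈ l, ∀ t, g < t → B.curve a.2 a.1 t = 1) :
    B.levelLoss k x l m ≤ max (-B.levelGain k x g) 0 := by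
  refine selectionLoss_le ((B.curveSpec hA hcost k).avg hA x)
    (B.isRetirementCurve_listCurve hA hcost l) (B.cont_nonneg x) (B.cont_le_one x) (hcost x) hmg
    fun t ht => List.prod_eq_one fun p hp => ?_
  obtain ⟨a, ha, rfl⟩ := List.mem_map.1 hp
  exact hl a ha t ht

/-- Finitely many generations of a list of actions achieve no more than the list itself. -/
theorem indexExcess_le_iSup (hA : ∀ n x, B.expAbsPayoff n x < ∞) (hcost : B.CostlyActions)
    (m : ℝ) (l : List (X × ℕ)) :
    B.indexExcess m l ≤ ⨆ n, B.excess m n (l.map Prod.fst) := by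
  -- Selecting an action replaces one generation number `k + 1` by arbitrarily many copies of `k`.
  -- The list may grow, but the multiset of generation numbers decreases in the well-founded hydra
  -- order.
  have wf : WellFounded (InvImage (Relation.CutExpand (· < ·))
      fun l : List (X × ℕ) => (l.map Prod.snd : Multiset ℕ)) :=
    InvImage.wf _ (WellFounded.cutExpand Nat.lt_wfRel.wf)
  induction l using wf.induction with
  | _ l ih =>
    choose g hmg hg hg' using fun a => B.exists_curve_threshold hA hcost m a
    have hzero : (∀ a ∈ l, g a = m) → B.indexExcess m l = 0 := by
      intro h
      rw [indexExcess, IsRetirementCurve.shortfall_eq_zero, ENNReal.ofReal_zero]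
      intro t ht
      refine List.prod_eq_one fun p hp => ?_
      obtain ⟨a, ha, rfl⟩ := List.mem_map.1 hp
      exact hg a t (by rwa [h a ha])
    rcases Nat.eq_zero_or_pos l.length with hlen | hlen
    · rw [hzero (by simp [List.length_eq_zero_iff.1 hlen])]
      exact zero_le
    have : Nonempty (Fin l.length) := ⟨⟨0, hlen⟩⟩
    -- The action with the greatest threshold is selected. If its threshold is `m`, all curves equal
    -- one beyond `m`; otherwise its net gain at the threshold is zero and the other curves equal
    -- one beyond it, so nothing is lost.
    obtain ⟨⟨i, hi⟩, hmax⟩ := Finite.exists_max fun j : Fin l.length => g l[j]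
    have hmax' : ∀ a ∈ l, g a ≤ g l[i] := fun a ha => by
      obtain ⟨j, hj, rfl⟩ := List.getElem_of_mem ha
      exact hmax ⟨j, hj⟩
    rcases hg' l[i] with hm | ⟨k, hk, hgain⟩
    · rw [hzero fun a ha => le_antisymm ((hmax' a ha).trans_eq hm) (hmg a)]
      exact zero_le
    have hloss : B.levelLoss k l[i].1 (l.eraseIdx i) m ≤ 0 := by
      have h := B.levelLoss_le hA hcost k l[i].1 (l.eraseIdx i) (hmg l[i]) fun a ha t ht =>
        hg a t ((hmax' a (List.mem_of_mem_eraseIdx ha)).trans_lt ht)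
      simpa [hgain] using h
    have hgain_eq := B.gain_indexExcess_eraseIdx hA hcost m l i hi k hk
    have hIH : ∀ t : List X, B.indexExcess m (l.eraseIdx i ++ t.map fun y => (y, k)) ≤
        ⨆ n, B.excess m n ((l.map Prod.fst).eraseIdx i ++ t) := by
      intro t
      have h := ih (l.eraseIdx i ++ t.map fun y => (y, k)) ?_
      · rwa [map_fst_append_level] at h
      refine ⟨(t.map fun _ => k : List ℕ), k + 1, ?_, ?_⟩
      · intro a' ha'
        obtain ⟨_, -, rfl⟩ := List.mem_map.1 (Multiset.mem_coe.1 ha')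
        exact Nat.lt_succ_self _
      · have hperm : (l.map Prod.snd : Multiset ℕ) =
            (k + 1) ::ₘ ((l.eraseIdx i).map Prod.snd : List ℕ) := by
          rw [← hk, Multiset.cons_coe, ← List.map_cons]
          exact (Multiset.coe_eq_coe.2 ((List.getElem_cons_eraseIdx_perm hi).map _)).symm
        simp only [hperm, List.map_append, List.map_map, Function.comp_def]
        rw [← Multiset.coe_add, ← Multiset.singleton_add]
        abel
    rw [indexExcess]
    refine ENNReal.le_of_forall_pos_le_add fun ε hε _ => ?_
    obtain ⟨n, hn⟩ := B.exists_gain_le hA m l[i].1 ((l.map Prod.fst).eraseIdx i) hIH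
      (B.lintegral_indexExcess_ne_top hA hcost k l[i].1 (l.eraseIdx i) m) (NNReal.coe_pos.2 hε)
    have h1 : shortfall (B.listCurve l) m ≤ B.gainAt m n (l.map Prod.fst) i + ε := by
      rw [gainAt_of_lt _ (by simpa using hi), List.getElem_map]
      linarith
    refine (ENNReal.ofReal_le_ofReal h1).trans (ENNReal.ofReal_add_le.trans ?_)
    refine add_le_add ((B.ofReal_gainAt_le m n _ i).trans ?_) (by simp)
    exact le_iSup (fun n => B.excess m n (l.map Prod.fst)) (n + 1)

end BranchingBandit

/-! ### The limit of many generations -/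

namespace BranchingBandit

open Filter Topology

variable {X : Type*} [MeasurableSpace X] (B : BranchingBandit X)

theorem value_eq_self_iff (hA : ∀ n x, B.expAbsPayoff n x < ∞) (m : ℝ) (s : List X) :
    B.value m s = (m : EReal) ↔ ∀ n, B.excess m n s = 0 := by
  rw [B.value_eq hA]
  constructor
  · intro h n
    have h1 := (le_iSup (fun n => ((m + (B.excess m n s).toReal : ℝ) : EReal)) n).trans h.le
    have h2 : (B.excess m n s).toReal ≤ 0 := by
      have := EReal.coe_le_coe_iff.1 h1
      linarith
    have h3 := le_antisymm h2 ENNReal.toReal_nonneg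
    exact ((ENNReal.toReal_eq_zero_iff _).1 h3).resolve_right (B.excess_lt_top hA m n s).ne
  · intro h
    simp [h]

theorem listCurve_le (hA : ∀ n x, B.expAbsPayoff n x < ∞) (hcost : B.CostlyActions)
    {l : List (X × ℕ)} {a : X × ℕ} (ha : a ∈ l) (t : ℝ) :
    B.listCurve l t ≤ B.curve a.2 a.1 t := by
  induction l with
  | nil => simp at ha
  | cons b l ih =>
    have hb := (B.curveSpec hA hcost b.2).isCurve b.1
    have hl := B.isRetirementCurve_listCurve hA hcost l
    have h : B.listCurve (b :: l) t = B.curve b.2 b.1 t * B.listCurve l t := by simp [listCurve]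
    rw [h]
    rcases List.mem_cons.1 ha with rfl | ha
    · exact mul_le_of_le_one_right (hb.nonneg t) (hl.le_one t)
    · exact (mul_le_of_le_one_left (hl.nonneg t) (hb.le_one t)).trans (ih ha)

theorem listCurve_eq_one {l : List (X × ℕ)} {t : ℝ} (h : ∀ a ∈ l, B.curve a.2 a.1 t = 1) :
    B.listCurve l t = 1 := by
  refine List.prod_eq_one fun p hp => ?_
  obtain ⟨a, ha, rfl⟩ := List.mem_map.1 hp
  exact h a ha

theorem map_fst_map_level {Y : Type*} (s : List Y) (k : ℕ) :
    (s.map fun y => (y, k)).map Prod.fst = s := by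
  simp [Function.comp_def]

theorem excess_le_ofReal_shortfall (hA : ∀ n x, B.expAbsPayoff n x < ∞) (hcost : B.CostlyActions)
    (m : ℝ) (s : List X) {n k : ℕ} (hnk : n ≤ k) :
    B.excess m n s ≤ ENNReal.ofReal (shortfall (B.listCurve (s.map fun y => (y, k))) m) := by
  have h := B.excess_le_indexExcess hA hcost m n (s.map fun y => (y, k)) fun a ha => by
    obtain ⟨y, -, rfl⟩ := List.mem_map.1 ha
    exact hnk
  rwa [map_fst_map_level] at h

theorem ofReal_shortfall_le_iSup (hA : ∀ n x, B.expAbsPayoff n x < ∞) (hcost : B.CostlyActions)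
    (m : ℝ) (s : List X) (k : ℕ) :
    ENNReal.ofReal (shortfall (B.listCurve (s.map fun y => (y, k))) m) ≤
      ⨆ n, B.excess m n s := by
  have h := B.indexExcess_le_iSup hA hcost m (s.map fun y => (y, k))
  rwa [map_fst_map_level] at h

/-- A product of numbers in `[0, 1]` is one if and only if every factor is. Thus stopping is optimal
for a list exactly when it is optimal for each action alone. -/
theorem forall_excess_eq_zero_iff (hA : ∀ n x, B.expAbsPayoff n x < ∞) (hcost : B.CostlyActions)
    (m : ℝ) (s : List X) :
    (∀ n, B.excess m n s = 0) ↔ ∀ x ∈ s, ∀ k t, m < t → B.curve k x t = 1 := by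
  constructor
  · intro h x hx k t ht
    have h1 := B.ofReal_shortfall_le_iSup hA hcost m s k
    simp only [h, ciSup_const] at h1
    have hc := B.isRetirementCurve_listCurve hA hcost (s.map fun y => (y, k))
    have h2 : shortfall (B.listCurve (s.map fun y => (y, k))) m = 0 :=
      le_antisymm (ENNReal.ofReal_eq_zero.1 (le_antisymm h1 zero_le)) (hc.shortfall_nonneg m)
    have h3 := hc.eq_one_of_shortfall h2 ht
    exact le_antisymm (((B.curveSpec hA hcost k).isCurve x).le_one t) (h3 ▸
      B.listCurve_le hA hcost (a := (x, k)) (List.mem_map.2 ⟨x, hx, rfl⟩) t)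
  · intro h n
    have h1 := B.excess_le_ofReal_shortfall hA hcost m s (le_refl n)
    rw [IsRetirementCurve.shortfall_eq_zero fun t ht => B.listCurve_eq_one fun a ha => ?_,
      ENNReal.ofReal_zero] at h1
    · exact le_antisymm h1 zero_le
    · obtain ⟨y, hy, rfl⟩ := List.mem_map.1 ha
      exact h y hy n t ht

theorem value_singleton_eq_self_iff (hA : ∀ n x, B.expAbsPayoff n x < ∞) (hcost : B.CostlyActions)
    (m : ℝ) (x : X) :
    B.value m [x] = (m : EReal) ↔ ∀ k t, m < t → B.curve k x t = 1 := by
  rw [B.value_eq_self_iff hA, B.forall_excess_eq_zero_iff hA hcost]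
  simp

theorem gittins_le_of_value_eq {m : ℝ} {x : X} (h : B.value m [x] = (m : EReal)) :
    B.gittins x ≤ m := sInf_le ⟨m, rfl, h⟩

theorem exists_value_eq_of_gittins_lt {x : X} {b : EReal} (h : B.gittins x < b) :
    ∃ a : ℝ, (a : EReal) < b ∧ B.value a [x] = (a : EReal) := by
  obtain ⟨_, ⟨a, rfl, ha⟩, hab⟩ := sInf_lt_iff.1 h
  exact ⟨a, hab, ha⟩

/-- Stopping is optimal if and only if the outside option is at least the Gittins index. -/
theorem gittins_le_iff (hA : ∀ n x, B.expAbsPayoff n x < ∞) (hcost : B.CostlyActions)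
    (m : ℝ) (x : X) : B.gittins x ≤ m ↔ B.value m [x] = (m : EReal) := by
  refine ⟨fun h => ?_, B.gittins_le_of_value_eq⟩
  rw [B.value_singleton_eq_self_iff hA hcost]
  intro k t ht
  obtain ⟨a, hat, ha⟩ :=
    B.exists_value_eq_of_gittins_lt (h.trans_lt (EReal.coe_lt_coe_iff.2 ht))
  exact (B.value_singleton_eq_self_iff hA hcost a x).1 ha k t (EReal.coe_lt_coe_iff.1 hat)

theorem value_eq_self_iff_gittins (hA : ∀ n x, B.expAbsPayoff n x < ∞) (hcost : B.CostlyActions)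
    (m : ℝ) (s : List X) :
    B.value m s = (m : EReal) ↔ ∀ x ∈ s, B.gittins x ≤ m := by
  rw [B.value_eq_self_iff hA, B.forall_excess_eq_zero_iff hA hcost]
  simp only [B.gittins_le_iff hA hcost, B.value_singleton_eq_self_iff hA hcost]

theorem curve_eq_one_of_gittins_le (hA : ∀ n x, B.expAbsPayoff n x < ∞) (hcost : B.CostlyActions)
    {m : ℝ} {x : X} (h : B.gittins x ≤ m) (k : ℕ) {t : ℝ} (ht : m < t) : B.curve k x t = 1 :=
  (B.value_singleton_eq_self_iff hA hcost m x).1 ((B.gittins_le_iff hA hcost m x).1 h) k t ht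

theorem exists_gittins_le (hB : B.BoundaryCondition) (m : ℝ) (s : List X) :
    ∃ M : ℝ, m ≤ M ∧ ∀ x ∈ s, B.gittins x ≤ M := by
  induction s with
  | nil => exact ⟨m, le_rfl, by simp⟩
  | cons y s ih =>
    obtain ⟨M, hmM, hM⟩ := ih
    obtain ⟨N, hN⟩ := hB.2 y
    refine ⟨max M N, hmM.trans (le_max_left _ _), fun x hx => ?_⟩
    rcases List.mem_cons.1 hx with rfl | hx
    · exact (B.gittins_le_of_value_eq hN).trans (EReal.coe_le_coe (le_max_right _ _))
    · exact (hM x hx).trans (EReal.coe_le_coe (le_max_left _ _))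

/-- Beyond a common upper bound `M` of the indices all curves equal one, so the shortfall at `m` is
at most `M - m`. -/
theorem exists_excess_le (hB : B.BoundaryCondition) (hcost : B.CostlyActions) (m : ℝ)
    (s : List X) : ∃ K : ℝ, 0 ≤ K ∧ ∀ n, B.excess m n s ≤ ENNReal.ofReal K := by
  obtain ⟨M, hmM, hM⟩ := B.exists_gittins_le hB m s
  refine ⟨M - m, sub_nonneg.2 hmM, fun n => (B.excess_le_ofReal_shortfall hB.1 hcost m s
    (le_refl n)).trans (ENNReal.ofReal_le_ofReal ?_)⟩
  have hc := B.isRetirementCurve_listCurve hB.1 hcost (s.map fun y => (y, n))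
  have h1 := hc.shortfall_sub_le hmM
  have h2 : shortfall (B.listCurve (s.map fun y => (y, n))) M = 0 :=
    IsRetirementCurve.shortfall_eq_zero fun t ht => B.listCurve_eq_one fun a ha => by
      obtain ⟨y, hy, rfl⟩ := List.mem_map.1 ha
      exact B.curve_eq_one_of_gittins_le hB.1 hcost (hM y hy) n ht
  nlinarith [hc.nonneg m]

/-- Excess of the value of a list of actions over the outside option. -/
noncomputable def limitExcess (m : ℝ) (s : List X) : ℝ := ⨆ n, (B.excess m n s).toReal

/-- Excess over the outside option of the best that begins with position `i`. -/
noncomputable def limitGainAt (m : ℝ) (s : List X) (i : ℕ) : ℝ := ⨆ n, B.gainAt m n s i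

theorem bddAbove_excess (hB : B.BoundaryCondition) (hcost : B.CostlyActions) (m : ℝ) (s : List X) :
    BddAbove (Set.range fun n => (B.excess m n s).toReal) := by
  obtain ⟨K, hK, h⟩ := B.exists_excess_le hB hcost m s
  refine ⟨K, ?_⟩
  rintro _ ⟨n, rfl⟩
  exact ENNReal.toReal_le_of_le_ofReal hK (h n)

theorem bddAbove_gainAt (hB : B.BoundaryCondition) (hcost : B.CostlyActions) (m : ℝ) (s : List X)
    (i : ℕ) : BddAbove (Set.range fun n => B.gainAt m n s i) := by
  obtain ⟨K, hK⟩ := B.bddAbove_excess hB hcost m s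
  refine ⟨K, ?_⟩
  rintro _ ⟨n, rfl⟩
  exact (B.gainAt_le_excess hB.1 m n s i).trans (hK ⟨n + 1, rfl⟩)

theorem tendsto_excess (hB : B.BoundaryCondition) (hcost : B.CostlyActions) (m : ℝ) (s : List X) :
    Tendsto (fun n => (B.excess m n s).toReal) atTop (𝓝 (B.limitExcess m s)) :=
  tendsto_atTop_ciSup (fun _ k hnk => ENNReal.toReal_mono (B.excess_lt_top hB.1 m k s).ne
    (B.excess_monotone hB.1 m s hnk)) (B.bddAbove_excess hB hcost m s)

theorem tendsto_gainAt (hB : B.BoundaryCondition) (hcost : B.CostlyActions) (m : ℝ) (s : List X)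
    (i : ℕ) : Tendsto (fun n => B.gainAt m n s i) atTop (𝓝 (B.limitGainAt m s i)) :=
  tendsto_atTop_ciSup (B.gainAt_monotone hB.1 m s i) (B.bddAbove_gainAt hB hcost m s i)

theorem value_eq_limitExcess (hB : B.BoundaryCondition) (hcost : B.CostlyActions) (m : ℝ)
    (s : List X) : B.value m s = ((m + B.limitExcess m s : ℝ) : EReal) := by
  rw [B.value_eq hB.1]
  refine tendsto_nhds_unique (tendsto_atTop_iSup fun n k hnk => EReal.coe_le_coe ?_)
    ((continuous_coe_real_ereal.tendsto _).comp ((B.tendsto_excess hB hcost m s).const_add m))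
  have := ENNReal.toReal_mono (B.excess_lt_top hB.1 m k s).ne (B.excess_monotone hB.1 m s hnk)
  linarith

theorem valueVia_eq_limitGainAt (hB : B.BoundaryCondition) (hcost : B.CostlyActions) (m : ℝ)
    (s : List X) (i : ℕ) : B.valueVia m s i = ((m + B.limitGainAt m s i : ℝ) : EReal) := by
  rw [B.valueVia_eq hB.1]
  refine tendsto_nhds_unique (tendsto_atTop_iSup fun n k hnk => EReal.coe_le_coe ?_)
    ((continuous_coe_real_ereal.tendsto _).comp ((B.tendsto_gainAt hB hcost m s i).const_add m))
  have := B.gainAt_monotone hB.1 m s i hnk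
  simp only at this
  linarith

theorem isOptimalChoice_iff_limit (hB : B.BoundaryCondition) (hcost : B.CostlyActions) (m : ℝ)
    (s : List X) (i : ℕ) :
    B.IsOptimalChoice m s i ↔ B.limitExcess m s - B.limitGainAt m s i = 0 := by
  rw [IsOptimalChoice, B.value_eq_limitExcess hB hcost, B.valueVia_eq_limitGainAt hB hcost,
    EReal.coe_eq_coe_iff]
  constructor <;> intro h <;> linarith

/-- Truncation to `k + 1` generations lies between `k` selections and the unrestricted value. The
shift to `k + 1` leaves `k` generations for the follow-up actions of whichever action is selected.
-/
theorem tendsto_shortfall_listCurve (hB : B.BoundaryCondition) (hcost : B.CostlyActions) (m : ℝ)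
    (s : List X) : Tendsto (fun k => shortfall (B.listCurve (s.map fun y => (y, k + 1))) m) atTop
      (𝓝 (B.limitExcess m s)) := by
  have hbdd := B.bddAbove_excess hB hcost m s
  refine tendsto_of_tendsto_of_tendsto_of_le_of_le (B.tendsto_excess hB hcost m s)
    tendsto_const_nhds (fun k => ?_) fun k => ?_
  · have h := (B.isRetirementCurve_listCurve hB.1 hcost
      (s.map fun y => (y, k + 1))).shortfall_nonneg m
    exact ENNReal.toReal_le_of_le_ofReal h
      (B.excess_le_ofReal_shortfall hB.1 hcost m s (Nat.le_succ k))
  · have h0 : 0 ≤ B.limitExcess m s := Real.iSup_nonneg fun n => ENNReal.toReal_nonneg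
    refine (ENNReal.ofReal_le_ofReal_iff h0).1 ((B.ofReal_shortfall_le_iSup hB.1 hcost m s
      (k + 1)).trans (iSup_le fun n => ?_))
    exact (ENNReal.le_ofReal_iff_toReal_le (B.excess_lt_top hB.1 m n s).ne h0).2
      (le_ciSup hbdd n)

/-- The same squeeze after one selection: unselected actions keep `k + 1` generations and follow-up
actions have `k`, so every action can be followed through at least `k` selections. -/
theorem tendsto_gain_indexExcess (hB : B.BoundaryCondition) (hcost : B.CostlyActions) (m : ℝ)
    (s : List X) (i : ℕ) (hi : i < s.length) :
    Tendsto (fun k => B.gain m s[i] fun t => B.indexExcess m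
        ((s.eraseIdx i).map (fun y => (y, k + 1)) ++ t.map fun y => (y, k))) atTop
      (𝓝 (B.limitGainAt m s i)) := by
  have hmap : ∀ (k : ℕ) (t : List X), ((s.eraseIdx i).map (fun y => (y, k + 1)) ++
      t.map fun y => (y, k)).map Prod.fst = s.eraseIdx i ++ t := fun k t => by
    simp [Function.comp_def]
  have hfin := fun k => B.lintegral_indexExcess_ne_top hB.1 hcost k s[i]
    ((s.eraseIdx i).map fun y => (y, k + 1)) m
  refine tendsto_of_tendsto_of_tendsto_of_le_of_le (B.tendsto_gainAt hB hcost m s i)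
    tendsto_const_nhds (fun k => ?_) fun k => ?_
  · simp only [B.gainAt_of_lt hi]
    refine B.gain_mono (g := fun t => B.indexExcess m
      ((s.eraseIdx i).map (fun y => (y, k + 1)) ++ t.map fun y => (y, k))) (fun t => ?_) (hfin k)
    rw [← hmap k t]
    refine B.excess_le_indexExcess hB.1 hcost m k _ fun a ha => ?_
    rcases List.mem_append.1 ha with h | h <;> obtain ⟨y, -, rfl⟩ := List.mem_map.1 h
    exacts [Nat.le_succ k, le_rfl]
  · refine le_of_forall_pos_le_add fun ε hε => ?_
    obtain ⟨n, hn⟩ := B.exists_gain_le hB.1 m s[i] (s.eraseIdx i) (f := fun t => B.indexExcess m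
      ((s.eraseIdx i).map (fun y => (y, k + 1)) ++ t.map fun y => (y, k)))
      (fun t => hmap k t ▸ B.indexExcess_le_iSup hB.1 hcost m _) (hfin k) hε
    have h1 : B.gainAt m n s i ≤ B.limitGainAt m s i :=
      le_ciSup (B.bddAbove_gainAt hB hcost m s i) n
    rw [B.gainAt_of_lt hi] at h1
    linarith

theorem tendsto_levelLoss (hB : B.BoundaryCondition) (hcost : B.CostlyActions) (m : ℝ)
    (s : List X) (i : ℕ) (hi : i < s.length) :
    Tendsto (fun k => B.levelLoss k s[i] ((s.eraseIdx i).map fun y => (y, k + 1)) m) atTop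
      (𝓝 (B.limitExcess m s - B.limitGainAt m s i)) := by
  refine ((B.tendsto_shortfall_listCurve hB hcost m s).sub
    (B.tendsto_gain_indexExcess hB hcost m s i hi)).congr fun k => ?_
  have hperm := ((List.getElem_cons_eraseIdx_perm hi).map fun y => (y, k + 1))
  rw [B.gain_indexExcess hB.1 hcost, ← B.listCurve_perm hperm, List.map_cons]
  ring

/-- An action is an optimal choice if and only if the loss from selecting it vanishes in the limit of
many generations. -/
theorem isOptimalChoice_iff_tendsto (hB : B.BoundaryCondition) (hcost : B.CostlyActions) (m : ℝ)
    (s : List X) (i : ℕ) (hi : i < s.length) :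
    B.IsOptimalChoice m s i ↔ Tendsto
      (fun k => B.levelLoss k s[i] ((s.eraseIdx i).map fun y => (y, k + 1)) m) atTop (𝓝 0) := by
  rw [B.isOptimalChoice_iff_limit hB hcost]
  have h := B.tendsto_levelLoss hB hcost m s i hi
  exact ⟨fun h0 => h0 ▸ h, fun h0 => tendsto_nhds_unique h h0⟩

end BranchingBandit

/-! ### Net gain in the limit and the index theorem -/

namespace BranchingBandit

open Filter Topology

variable {X : Type*} [MeasurableSpace X] (B : BranchingBandit X)

/-- Net gain from a single action over the outside option. -/
noncomputable def limitGain (x : X) (c : ℝ) : ℝ := B.limitGainAt c [x] 0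

theorem tendsto_levelGain (hB : B.BoundaryCondition) (hcost : B.CostlyActions) (x : X) (c : ℝ) :
    Tendsto (fun k => B.levelGain k x c) atTop (𝓝 (B.limitGain x c)) := by
  refine (B.tendsto_gain_indexExcess hB hcost c [x] 0 (by simp)).congr fun k => ?_
  have h1 : B.listCurve [] = fun _ => 1 := by
    funext t
    simp [listCurve]
  have h := B.lintegral_indexExcess hB.1 hcost k x [] c
  simp only [h1, mul_one] at h
  simp only [List.getElem_cons_zero, List.eraseIdx_zero, List.tail_cons, List.map_nil, gain, h]
  rw [ENNReal.toReal_ofReal (((B.curveSpec hB.1 hcost k).avg hB.1 x).shortfall_nonneg c)]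
  rfl

theorem excess_singleton (m : ℝ) (n : ℕ) (x : X) :
    B.excess m (n + 1) [x] = ENNReal.ofReal (B.gainAt m n [x] 0) := by
  refine le_antisymm ?_ (B.ofReal_gainAt_le m n [x] 0)
  rw [excess_succ]
  refine iSup_le fun i => ?_
  cases i with
  | zero => exact le_rfl
  | succ i =>
    rw [gainAt_of_le _ (by simp), ENNReal.ofReal_zero]
    exact zero_le

theorem gittins_le_iff_limitGain (hB : B.BoundaryCondition) (hcost : B.CostlyActions) (x : X)
    (c : ℝ) : B.gittins x ≤ c ↔ B.limitGain x c ≤ 0 := by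
  rw [B.gittins_le_iff hB.1 hcost, B.value_eq_self_iff hB.1]
  constructor
  · intro h
    refine ciSup_le fun n => ENNReal.ofReal_eq_zero.1 ?_
    rw [← excess_singleton, h]
  · intro h n
    cases n with
    | zero => rfl
    | succ n =>
      rw [excess_singleton, ENNReal.ofReal_eq_zero]
      exact (le_ciSup (B.bddAbove_gainAt hB hcost c [x] 0) n).trans h

theorem limitGain_sub_le (hB : B.BoundaryCondition) (hcost : B.CostlyActions) (x : X) {a b : ℝ}
    (hab : a ≤ b) : B.limitGain x a - B.limitGain x b ≤ b - a :=
  le_of_tendsto' ((B.tendsto_levelGain hB hcost x a).sub (B.tendsto_levelGain hB hcost x b))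
    fun k => netGain_sub_le_sub ((B.curveSpec hB.1 hcost k).avg hB.1 x) (B.cont_nonneg x) hab

theorem limitGain_sub_ge (hB : B.BoundaryCondition) (hcost : B.CostlyActions) (x : X) {a b : ℝ}
    (hab : a ≤ b) : (b - a) * (1 - B.cont x) ≤ B.limitGain x a - B.limitGain x b := by
  refine ge_of_tendsto' ((B.tendsto_levelGain hB hcost x a).sub
    (B.tendsto_levelGain hB hcost x b)) fun k => ?_
  have havg := (B.curveSpec hB.1 hcost k).avg hB.1 x
  refine le_trans (mul_le_mul_of_nonneg_left ?_ (sub_nonneg.2 hab))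
    (le_netGain_sub havg (B.cont_nonneg x) hab)
  have := mul_le_of_le_one_right (B.cont_nonneg x) (havg.le_one b)
  linarith

/-- The net gain from a single action is a convex function of the outside option. -/
theorem limitGain_convex (hB : B.BoundaryCondition) (hcost : B.CostlyActions) (x : X) {a b c : ℝ}
    (hab : a ≤ b) (hbc : b ≤ c) :
    (b - a) * (B.limitGain x b - B.limitGain x c) ≤
      (c - b) * (B.limitGain x a - B.limitGain x b) := by
  have ha := B.tendsto_levelGain hB hcost x a
  have hb := B.tendsto_levelGain hB hcost x b
  have hc := B.tendsto_levelGain hB hcost x c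
  refine le_of_tendsto_of_tendsto' ((hb.sub hc).const_mul _) ((ha.sub hb).const_mul _) fun k => ?_
  have havg := (B.curveSpec hB.1 hcost k).avg hB.1 x
  have h1 := netGain_sub_le (ρ := B.meanPayoff x) havg (B.cont_nonneg x) hbc
  have h2 := le_netGain_sub (ρ := B.meanPayoff x) havg (B.cont_nonneg x) hab
  have h3 := mul_le_mul_of_nonneg_left h1 (sub_nonneg.2 hab)
  have h4 := mul_le_mul_of_nonneg_left h2 (sub_nonneg.2 hbc)
  refine h3.trans (le_trans (le_of_eq ?_) h4)
  ring

/-- Monotonicity is inherited from the shortfalls of the curves, between which the finite-horizon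
excesses are interlaced. -/
theorem iSup_excess_antitone (hA : ∀ n x, B.expAbsPayoff n x < ∞) (hcost : B.CostlyActions)
    (s : List X) : Antitone fun c => ⨆ n, B.excess c n s := fun a b hab =>
  iSup_le fun n => (B.excess_le_ofReal_shortfall hA hcost b s (le_refl n)).trans
    ((ENNReal.ofReal_le_ofReal ((B.isRetirementCurve_listCurve hA hcost _).shortfall_antitone
      hab)).trans (B.ofReal_shortfall_le_iSup hA hcost a s n))

theorem measurable_iSup_excess (c : ℝ) : Measurable fun o : ℝ × List X =>
    ⨆ n, B.excess c n o.2 :=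
  Measurable.iSup fun n => B.measurable_excess_outcome c n []

theorem gainAt_singleton (m : ℝ) (n : ℕ) (x : X) :
    B.gainAt m n [x] 0 = B.gain m x (B.excess m n) := by
  simp [gainAt]

/-- The expected excess of the follow-up actions of an undiscounted action. -/
theorem lintegral_iSup_excess (hB : B.BoundaryCondition) (hcost : B.CostlyActions) (x : X)
    (hx : B.cont x = 1) (c : ℝ) :
    ∫⁻ o, (⨆ n, B.excess c n o.2) ∂(B.outcome x) =
      ENNReal.ofReal (B.limitGain x c - B.meanPayoff x) := by
  have hm : ∀ n, ∫⁻ o, B.excess c n o.2 ∂(B.outcome x) =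
      ENNReal.ofReal (B.gainAt c n [x] 0 - B.meanPayoff x) := fun n => by
    have hfin := (B.lintegral_excess_lt_top hB.1 c n x []).ne
    simp only [List.nil_append] at hfin
    rw [gainAt_singleton, gain, hx, one_mul]
    have : B.meanPayoff x + (c + (∫⁻ o, B.excess c n o.2 ∂(B.outcome x)).toReal) - c -
        B.meanPayoff x = (∫⁻ o, B.excess c n o.2 ∂(B.outcome x)).toReal := by ring
    rw [this, ENNReal.ofReal_toReal hfin]
  have hmono : Monotone fun n => ∫⁻ o, B.excess c n o.2 ∂(B.outcome x) := fun n k hnk =>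
    lintegral_mono fun o => B.excess_monotone hB.1 c o.2 hnk
  rw [lintegral_iSup (f := fun n (o : ℝ × List X) => B.excess c n o.2)
    (fun n => B.measurable_excess_outcome c n [])
    fun n k hnk o => B.excess_monotone hB.1 c _ hnk]
  refine tendsto_nhds_unique (tendsto_atTop_iSup hmono) ?_
  simp only [hm]
  exact ENNReal.tendsto_ofReal ((B.tendsto_gainAt hB hcost c [x] 0).sub_const _)

/-- The net gain from a costly action is negative beyond its Gittins index. -/
theorem limitGain_neg (hB : B.BoundaryCondition) (hcost : B.CostlyActions) (x : X) {b : ℝ}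
    (hb : B.gittins x < b) : B.limitGain x b < 0 := by
  obtain ⟨a, hab, ha⟩ := B.exists_value_eq_of_gittins_lt hb
  have hab' : a < b := EReal.coe_lt_coe_iff.1 hab
  have hUa : B.limitGain x a ≤ 0 :=
    (B.gittins_le_iff_limitGain hB hcost x a).1 (B.gittins_le_of_value_eq ha)
  by_cases hδ : B.cont x < 1
  · have h := B.limitGain_sub_ge hB hcost x hab'.le
    have := mul_pos (sub_pos.2 hab') (sub_pos.2 hδ)
    linarith
  have hρ : B.meanPayoff x < 0 := (hcost x).resolve_left hδ
  have hx : B.cont x = 1 := le_antisymm (B.cont_le_one x) (not_lt.1 hδ)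
  by_contra hUb
  -- A convex function that is at most zero at `a` and at least zero at `b > a` stays at least zero
  -- beyond `b`. The expected excess of the follow-up actions would then offset the cost at every
  -- outside option, however high.
  have hnonneg : ∀ c, b ≤ c → 0 ≤ B.limitGain x c := fun c hc => by
    have h := B.limitGain_convex hB hcost x hab'.le hc
    have h1 : (c - b) * (B.limitGain x a - B.limitGain x b) ≤ 0 :=
      mul_nonpos_of_nonneg_of_nonpos (sub_nonneg.2 hc) (by linarith [not_lt.1 hUb])
    have h2 : B.limitGain x b - B.limitGain x c ≤ 0 := by
      by_contra h3
      exact absurd (h.trans h1) (not_le.2 (mul_pos (sub_pos.2 hab') (not_le.1 h3)))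
    linarith [not_lt.1 hUb]
  have hlow : ∀ j : ℕ, ENNReal.ofReal (-B.meanPayoff x) ≤
      ∫⁻ o, (⨆ n, B.excess (b + j) n o.2) ∂(B.outcome x) := fun j => by
    rw [B.lintegral_iSup_excess hB hcost x hx]
    refine ENNReal.ofReal_le_ofReal ?_
    linarith [hnonneg (b + j) (by simp)]
  have hlim : Tendsto (fun j : ℕ => ∫⁻ o, (⨆ n, B.excess (b + j) n o.2) ∂(B.outcome x)) atTop
      (𝓝 (∫⁻ _, 0 ∂(B.outcome x))) := by
    refine tendsto_lintegral_of_dominated_convergence (fun o => ⨆ n, B.excess b n o.2)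
      (fun j => B.measurable_iSup_excess _) (fun j => ae_of_all _ fun o =>
        B.iSup_excess_antitone hB.1 hcost o.2 (by simp)) ?_ (ae_of_all _ fun o => ?_)
    · rw [B.lintegral_iSup_excess hB hcost x hx]
      exact ENNReal.ofReal_ne_top
    -- For each outcome the finitely many follow-up actions have a common bound on their indices,
    -- beyond which their excess is zero. Dominated convergence then makes the expected excess
    -- vanish.
    · obtain ⟨M, -, hM⟩ := B.exists_gittins_le hB 0 o.2
      obtain ⟨j₀, hj₀⟩ := exists_nat_ge (M - b)
      refine tendsto_const_nhds.congr' ?_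
      filter_upwards [eventually_ge_atTop j₀] with j hj
      have hMj : M ≤ b + j := by
        have : (j₀ : ℝ) ≤ j := Nat.cast_le.2 hj
        linarith
      have h := (B.value_eq_self_iff_gittins hB.1 hcost (b + j) o.2).2 fun y hy =>
        (hM y hy).trans (EReal.coe_le_coe hMj)
      simp [(B.value_eq_self_iff hB.1 _ _).1 h]
  have h := ge_of_tendsto' hlim hlow
  rw [lintegral_zero] at h
  have := ENNReal.ofReal_eq_zero.1 (le_antisymm h zero_le)
  linarith

theorem isOptimalChoice_of_gittins (hB : B.BoundaryCondition) (hcost : B.CostlyActions) {m : ℝ}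
    {s : List X} {i : ℕ} (hi : i < s.length) (hm : (m : EReal) ≤ B.gittins s[i])
    (hs : ∀ y ∈ s, B.gittins y ≤ B.gittins s[i]) : B.IsOptimalChoice m s i := by
  obtain ⟨M, hM⟩ := hB.2 s[i]
  have htop : B.gittins s[i] ≠ ⊤ :=
    ((B.gittins_le_of_value_eq hM).trans_lt (EReal.coe_lt_top M)).ne
  have hbot : B.gittins s[i] ≠ ⊥ := ((EReal.bot_lt_coe m).trans_le hm).ne'
  obtain ⟨g, hg⟩ : ∃ g : ℝ, (g : EReal) = B.gittins s[i] := ⟨_, EReal.coe_toReal htop hbot⟩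
  rw [← hg] at hm hs
  have hmg : m ≤ g := EReal.coe_le_coe_iff.1 hm
  -- The net gain falls at rate at most one. If it were negative at `g`, it would already be at most
  -- zero at `g + B.limitGain s[i] g < g`, below the index.
  have hU : 0 ≤ B.limitGain s[i] g := by
    by_contra hneg
    have hneg' := not_le.1 hneg
    have h1 := B.limitGain_sub_le hB hcost s[i] (a := g + B.limitGain s[i] g) (b := g)
      (by linarith)
    have h2 := (B.gittins_le_iff_limitGain hB hcost s[i] (g + B.limitGain s[i] g)).2 (by linarith)
    rw [← hg, EReal.coe_le_coe_iff] at h2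
    linarith
  rw [B.isOptimalChoice_iff_tendsto hB hcost m s i hi]
  have hmax := (B.tendsto_levelGain hB hcost s[i] g).neg.max (tendsto_const_nhds (x := (0 : ℝ)))
  rw [max_eq_right (by linarith)] at hmax
  refine tendsto_of_tendsto_of_tendsto_of_le_of_le tendsto_const_nhds hmax
    (fun k => B.levelLoss_nonneg hB.1 hcost k _ _ m) fun k => ?_
  refine B.levelLoss_le hB.1 hcost k s[i] _ hmg fun a ha t ht => ?_
  obtain ⟨y, hy, rfl⟩ := List.mem_map.1 ha
  exact B.curve_eq_one_of_gittins_le hB.1 hcost (hs y (List.mem_of_mem_eraseIdx hy)) (k + 1) ht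

/-- Below the outside option, the loss is at least the negative net gain at `m`, which stays away
from zero by `limitGain_neg`. -/
theorem le_gittins_of_isOptimalChoice (hB : B.BoundaryCondition) (hcost : B.CostlyActions) {m : ℝ}
    {s : List X} {i : ℕ} (hi : i < s.length) (h : B.IsOptimalChoice m s i) :
    (m : EReal) ≤ B.gittins s[i] := by
  by_contra hlt
  have hneg := B.limitGain_neg hB hcost s[i] (not_le.1 hlt)
  rw [B.isOptimalChoice_iff_tendsto hB hcost m s i hi] at h
  have := le_of_tendsto_of_tendsto' (B.tendsto_levelGain hB hcost s[i] m).neg h fun k =>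
    neg_netGain_le_selectionLoss ((B.curveSpec hB.1 hcost k).avg hB.1 s[i])
      (B.isRetirementCurve_listCurve hB.1 hcost _) (B.cont_nonneg _) (B.cont_le_one _) (hcost _) m
  linarith

/-- At an outside option `b` strictly between the two indices, `s[i]` has negative and `y` positive
net gain. Since `y` is among the other actions, the product of the two magnitudes is eventually at
most a constant times the loss, which therefore cannot tend to zero. -/
theorem gittins_le_of_isOptimalChoice (hB : B.BoundaryCondition) (hcost : B.CostlyActions) {m : ℝ}
    {s : List X} {i : ℕ} (hi : i < s.length) (h : B.IsOptimalChoice m s i) {y : X} (hy : y ∈ s) :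
    B.gittins y ≤ B.gittins s[i] := by
  by_contra hlt
  obtain ⟨b, hb1, hb2⟩ := EReal.lt_iff_exists_real_btwn.1 (not_le.1 hlt)
  have hUi := B.limitGain_neg hB hcost s[i] hb1
  have hUy : 0 < B.limitGain y b := by
    by_contra hle
    exact absurd ((B.gittins_le_iff_limitGain hB hcost y b).2 (not_lt.1 hle)) (not_le.2 hb2)
  have hmem : y ∈ s.eraseIdx i := by
    have h1 := (List.getElem_cons_eraseIdx_perm hi).mem_iff.2 hy
    rcases List.mem_cons.1 h1 with rfl | h2
    · exact absurd le_rfl hlt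
    · exact h2
  -- The curve of `y` equals one beyond `M`, so its net gain at `b` is at most `M - b` times the
  -- distance of its curve from one at `b`.
  obtain ⟨M, hbM, hM⟩ := B.exists_gittins_le hB b [y]
  have hM' : B.gittins y ≤ M := hM y (by simp)
  have hgi := B.tendsto_levelGain hB hcost s[i] b
  have hgy := B.tendsto_levelGain hB hcost y b
  rw [B.isOptimalChoice_iff_tendsto hB hcost m s i hi] at h
  have hle := le_of_tendsto_of_tendsto ((hgi.neg).mul hgy) (h.const_mul (M - b)) ?_
  · rw [mul_zero] at hle
    exact absurd hle (not_le.2 (mul_pos (neg_pos.2 hUi) hUy))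
  filter_upwards [hgi.eventually (gt_mem_nhds hUi)] with k hk
  have hl := B.isRetirementCurve_listCurve hB.1 hcost ((s.eraseIdx i).map fun y => (y, k + 1))
  have h1 : (1 - B.listCurve ((s.eraseIdx i).map fun y => (y, k + 1)) b) * -B.levelGain k s[i] b ≤
      B.levelLoss k s[i] ((s.eraseIdx i).map fun y => (y, k + 1)) m :=
    mul_neg_netGain_le_selectionLoss ((B.curveSpec hB.1 hcost k).avg hB.1 s[i]) hl
      (B.cont_nonneg _) (B.cont_le_one _) (hcost _) m b
  have h2 := B.listCurve_le hB.1 hcost (a := (y, k + 1))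
    (l := (s.eraseIdx i).map fun y => (y, k + 1)) (List.mem_map.2 ⟨y, hmem, rfl⟩) b
  have hc := (B.curveSpec hB.1 hcost (k + 1)).isCurve y
  have h3 : B.levelGain k y b ≤ shortfall (B.curve (k + 1) y) b :=
    (le_max_left _ _).trans_eq (shortfall_stepCurve ((B.curveSpec hB.1 hcost k).avg hB.1 y)
      (B.cont_nonneg y) (B.cont_le_one y) (hcost y) b).symm
  have h4 : shortfall (B.curve (k + 1) y) M = 0 :=
    IsRetirementCurve.shortfall_eq_zero fun t ht =>
      B.curve_eq_one_of_gittins_le hB.1 hcost hM' (k + 1) ht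
  have h5 := hc.shortfall_sub_le hbM
  have h6 : B.levelGain k y b ≤
      (M - b) * (1 - B.listCurve ((s.eraseIdx i).map fun y => (y, k + 1)) b) := by
    have := mul_le_mul_of_nonneg_left h2 (sub_nonneg.2 hbM)
    simp only at this
    linarith
  have h7 := mul_le_mul_of_nonneg_left h6 (neg_pos.2 hk).le
  have h8 := mul_le_mul_of_nonneg_left h1 (sub_nonneg.2 hbM)
  linarith

/-- Index theorem: selecting an action is an optimal choice if and only if no option has a higher
value. -/
theorem isOptimalChoice_iff (hB : B.BoundaryCondition) (hcost : B.CostlyActions) (m : ℝ)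
    (s : List X) (i : ℕ) (hi : i < s.length) :
    B.IsOptimalChoice m s i ↔
      (m : EReal) ≤ B.gittins s[i] ∧ ∀ y ∈ s, B.gittins y ≤ B.gittins s[i] :=
  ⟨fun h => ⟨B.le_gittins_of_isOptimalChoice hB hcost hi h,
    fun _ hy => B.gittins_le_of_isOptimalChoice hB hcost hi h hy⟩,
    fun h => B.isOptimalChoice_of_gittins hB hcost hi h.1 h.2⟩

theorem isOptimalChoice_outside_iff (hB : B.BoundaryCondition) (hcost : B.CostlyActions) (m : ℝ)
    (s : List X) (i : ℕ) (hi : s.length ≤ i) :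
    B.IsOptimalChoice m s i ↔ ∀ y ∈ s, B.gittins y ≤ m := by
  rw [← B.value_eq_self_iff_gittins hB.1 hcost, IsOptimalChoice, B.valueVia_eq hB.1]
  simp only [B.gainAt_of_le hi, add_zero, ciSup_const]
  exact eq_comm

end BranchingBandit

/-! ### Availability and values along a realized process -/

namespace DecisionProcess

variable {X : Type*} [MeasurableSpace X] {B : BranchingBandit X} {Act : Type*} [DecidableEq Act]
  (P : DecisionProcess B Act)

theorem exists_selected_eq_some {j : ℕ} (hj : j + 1 < P.steps) : ∃ a, P.selected j = some a :=
  (P.continues j hj).imp fun _ h => h.1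

theorem selected_mem_choiceSet {j : ℕ} (hj : j < P.steps) : P.selected j ∈ P.choiceSet j := by
  unfold choiceSet
  cases h : P.selected j with
  | none => exact Finset.none_mem_insertNone
  | some a => exact Finset.some_mem_insertNone.2 (P.selected_mem j a hj h)

/-- An option that is not selected stays available. -/
theorem mem_choiceSet_of_not_selected {o : Option Act} {i j : ℕ} (hij : i ≤ j) (hj : j < P.steps)
    (ho : o ∈ P.choiceSet i) (hns : ∀ k, i ≤ k → k < j → P.selected k ≠ o) :
    o ∈ P.choiceSet j := by
  induction j, hij using Nat.le_induction with
  | base => exact ho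
  | succ j hij ih =>
    have h := ih (Nat.lt_of_succ_lt hj) fun k hk hkj => hns k hk (hkj.trans (Nat.lt_succ_self j))
    obtain ⟨a, ha⟩ := P.exists_selected_eq_some hj
    unfold choiceSet at h ⊢
    cases o with
    | none => exact Finset.none_mem_insertNone
    | some b =>
      rw [Finset.some_mem_insertNone] at h ⊢
      rw [P.available_succ j a hj ha]
      refine Finset.mem_union_left _ (Finset.mem_erase.2 ⟨?_, h⟩)
      rintro rfl
      exact hns j hij (Nat.lt_succ_self j) ha

/-- A selected action is not available any more, and the follow-up actions of an action appear only
after it has been selected. -/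
theorem not_mem_available (j : ℕ) (hj : j < P.steps) :
    (∀ i a, i < j → P.selected i = some a → a ∉ P.available j) ∧
    ∀ b, (∀ i, i < j → P.selected i ≠ some b) → ∀ c ∈ P.children b,
      c ∉ P.available j ∧ ∀ i, i < j → P.selected i ≠ some c := by
  induction j with
  | zero =>
    refine ⟨fun i a hi => absurd hi (Nat.not_lt_zero i), fun b _ c hc => ⟨fun h => ?_,
      fun i hi => absurd hi (Nat.not_lt_zero i)⟩⟩
    rw [P.available_zero] at h
    exact Finset.disjoint_left.1 (P.disjoint_initial b) h hc
  | succ j ih =>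
    have hj' := Nat.lt_of_succ_lt hj
    obtain ⟨ih1, ih2⟩ := ih hj'
    obtain ⟨a, ha⟩ := P.exists_selected_eq_some hj
    have haj := P.selected_mem j a hj' ha
    have hnew : ∀ i, i < j → P.selected i ≠ some a := fun i hi h => ih1 i a hi h haj
    rw [P.available_succ j a hj ha]
    constructor
    · intro i d hi hd hmem
      rcases Finset.mem_union.1 hmem with h | h
      · obtain ⟨hda, hdj⟩ := Finset.mem_erase.1 h
        rcases (Nat.lt_succ_iff.1 hi).lt_or_eq with hlt | rfl
        · exact ih1 i d hlt hd hdj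
        · exact hda (Option.some_injective _ (hd.symm.trans ha))
      -- A follow-up action of `a` can neither have been available nor have been selected before `a`
      -- was, so no selected action re-enters.
      · obtain ⟨h1, h2⟩ := ih2 a hnew d h
        rcases (Nat.lt_succ_iff.1 hi).lt_or_eq with hlt | rfl
        · exact h2 i hlt hd
        · exact h1 (P.selected_mem i d hj' hd)
    · intro b hb c hc
      obtain ⟨h1, h2⟩ := ih2 b (fun i hi => hb i (hi.trans (Nat.lt_succ_self j))) c hc
      have hba : b ≠ a := fun h => hb j (Nat.lt_succ_self j) (h ▸ ha)
      refine ⟨fun hmem => ?_, fun i hi hsel => ?_⟩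
      · rcases Finset.mem_union.1 hmem with h | h
        · exact h1 (Finset.mem_erase.1 h).2
        · exact Finset.disjoint_left.1 (P.disjoint_children b a hba) hc h
      · rcases (Nat.lt_succ_iff.1 hi).lt_or_eq with hlt | rfl
        · exact h2 i hlt hsel
        · exact h1 (P.selected_mem i c hj' hsel)

/-- An option of the current choice set has not been selected before. -/
theorem selected_ne_of_mem_choiceSet {o : Option Act} {i j : ℕ} (hij : i < j) (hj : j < P.steps)
    (ho : o ∈ P.choiceSet j) : P.selected i ≠ o := by
  intro hsel
  obtain ⟨a, ha⟩ := P.exists_selected_eq_some (j := i) (by omega)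
  rw [← hsel, ha] at ho
  exact (P.not_mem_available j hj).1 i a hij ha (Finset.some_mem_insertNone.1 ho)

theorem forall_mem_choiceList {j : ℕ} {p : X → Prop} :
    (∀ y ∈ P.choiceList j, p y) ↔ ∀ a ∈ P.available j, p (P.state a) := by
  simp [choiceList]

/-- A choice in the process is optimal if and only if no option has a higher value. -/
theorem isOptimalChoice_iff (hB : B.BoundaryCondition) (hcost : B.CostlyActions) (u₀ : ℝ) {j : ℕ}
    {o : Option Act} (ho : o ∈ P.choiceSet j) :
    B.IsOptimalChoice u₀ (P.choiceList j) (P.position j o) ↔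
      ∀ o' ∈ P.choiceSet j, P.val u₀ o' ≤ P.val u₀ o := by
  have hforall : (∀ o' ∈ P.choiceSet j, P.val u₀ o' ≤ P.val u₀ o) ↔
      (u₀ : EReal) ≤ P.val u₀ o ∧ ∀ a ∈ P.available j, B.gittins (P.state a) ≤ P.val u₀ o := by
    constructor
    · exact fun h => ⟨h none Finset.none_mem_insertNone,
        fun a ha => h (some a) (Finset.some_mem_insertNone.2 ha)⟩
    · rintro ⟨h1, h2⟩ (_ | a) ho'
      · exact h1
      · exact h2 a (Finset.some_mem_insertNone.1 ho')
  rw [hforall]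
  cases o with
  | none =>
    rw [B.isOptimalChoice_outside_iff hB hcost _ _ _ (by simp [choiceList, position]),
      forall_mem_choiceList]
    exact ⟨fun h => ⟨le_rfl, h⟩, fun h => h.2⟩
  | some a =>
    have ha : a ∈ (P.available j).toList := Finset.mem_toList.2 (Finset.some_mem_insertNone.1 ho)
    have hi : P.position j (some a) < (P.choiceList j).length := by
      simpa [choiceList, position] using List.idxOf_lt_length_of_mem ha
    have hstate : (P.choiceList j)[P.position j (some a)] = P.state a := by
      simp [choiceList, position]
    rw [B.isOptimalChoice_iff hB hcost _ _ _ hi, hstate, forall_mem_choiceList]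
    rfl

theorem isOptimal_iff (hB : B.BoundaryCondition) (hcost : B.CostlyActions) (u₀ : ℝ) :
    P.IsOptimal u₀ ↔ ∀ j, j < P.steps → ∀ o ∈ P.choiceSet j,
      P.val u₀ o ≤ P.val u₀ (P.selected j) :=
  forall₂_congr fun _ hj => P.isOptimalChoice_iff hB hcost u₀ (P.selected_mem_choiceSet hj)

theorem val_le_subCoreValue {u₀ : ℝ} (h : ∀ j, j < P.steps → ∀ o ∈ P.choiceSet j,
    P.val u₀ o ≤ P.val u₀ (P.selected j)) {o : Option Act} (ho : P.Unselected o) :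
    P.val u₀ o ≤ P.subCoreValue u₀ o := by
  refine le_iInf₂ fun j hj => ?_
  obtain ⟨hj, -, i, hij, hi⟩ := hj
  exact h j hj o (P.mem_choiceSet_of_not_selected hij hj hi fun k _ hk => ho.2 k (hk.trans hj))

/-- If later selections have lower values, and unselected options have values at most their sub-core
values, then every selection has the highest value of its choice set. -/
theorem val_le_val_selected {u₀ : ℝ}
    (h1 : ∀ j t, 0 < t → j + t < P.steps → P.selected (j + t) ∈ P.choiceSet j →
      P.val u₀ (P.selected j) > P.val u₀ (P.selected (j + t)))
    (h2 : ∀ o, P.Unselected o → P.val u₀ o ≤ P.subCoreValue u₀ o) (j : ℕ) (hj : j < P.steps)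
    (o : Option Act) (ho : o ∈ P.choiceSet j) : P.val u₀ o ≤ P.val u₀ (P.selected j) := by
  have h1' : ∀ k, j < k → k < P.steps → P.selected k ∈ P.choiceSet j →
      P.val u₀ (P.selected k) < P.val u₀ (P.selected j) := by
    intro k hjk hk hmem
    have h := h1 j (k - j) (by omega) (by omega)
    rw [Nat.add_sub_cancel' hjk.le] at h
    exact h hmem
  by_cases hsel : ∃ k, k < P.steps ∧ P.selected k = o
  · obtain ⟨k, hk, rfl⟩ := hsel
    rcases lt_trichotomy k j with hkj | rfl | hjk
    · exact absurd rfl (P.selected_ne_of_mem_choiceSet hkj hj ho)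
    · exact le_rfl
    · exact (h1' k hjk hk ho).le
  · push Not at hsel
    by_cases hacc : P.ForwardAccessible j
    · obtain ⟨o', ho', -, k, hjk, hk, rfl⟩ := hacc
      have hok := P.mem_choiceSet_of_not_selected hjk.le hk ho fun i _ hi => hsel i (hi.trans hk)
      exact (val_le_val_selected h1 h2 k hk o hok).trans (h1' k hjk hk ho').le
    -- A forward-inaccessible step with `o` available is itself one of those over which the sub-core
    -- value is the minimum.
    · exact (h2 o ⟨⟨j, hj, ho⟩, hsel⟩).trans (iInf₂_le j ⟨hj, hacc, j, le_rfl, ho⟩)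
termination_by P.steps - j

end DecisionProcess

theorem theorem3 {X : Type*} [MeasurableSpace X] (B : BranchingBandit X)
    (hB : B.BoundaryCondition) (hcost : B.CostlyActions)
    {Act : Type*} [DecidableEq Act] (P : DecisionProcess B Act) (u₀ : ℝ)
    (hties : ∀ j k, j < k → k < P.steps → P.selected k ∈ P.choiceSet j →
      P.val u₀ (P.selected j) ≠ P.val u₀ (P.selected k)) :
    P.IsOptimal u₀ ↔
      (∀ j t, 0 < t → j + t < P.steps → P.selected (j + t) ∈ P.choiceSet j →
        P.val u₀ (P.selected j) > P.val u₀ (P.selected (j + t))) ∧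
      (∀ o, P.Unselected o → P.val u₀ o ≤ P.subCoreValue u₀ o) := by
  rw [P.isOptimal_iff hB hcost]
  constructor
  · intro h
    refine ⟨fun j t ht hjt hmem => ?_, fun o ho => P.val_le_subCoreValue h ho⟩
    exact lt_of_le_of_ne (h j (by omega) _ hmem) (hties j (j + t) (by omega) hjt hmem).symm
  · rintro ⟨h1, h2⟩ j hj o ho
    exact P.val_le_val_selected h1 h2 j hj o ho
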